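/- In the decision problem \textsc{Directed Power Vertex Cover} (DPVC) the input consists of a finite simple graph $G=(V,E)$, two positive integer demands $w_{u,v}$ and $w_{v,u}$ for every edge $uv\in E$, and an integer $P\ge 0$. The question is whether there is an assignment of powers $p_v\in\mathbb{N}$ to the vertices such that for every edge $uv\in E$ we have $p_u\ge w_{u,v}$ or $p_v\ge w_{v,u}$, and such that $\sum_{v\in V}p_v\le P$. Theorem. DPVC can be solved in time $O^*(1.325^P)$: there are an algorithm and constants $C,d\in\mathbb{N}$ such that, on every input $(G,w,P)$, the algorithm halts with the correct YES/NO answer after at most $C\cdot s^{d}\cdot 1.325^{P}$ steps, where $s$ is the size of the input: the $|V|\times|V|$ matrix of demands (with entry $0$ for non-adjacent pairs) and $P$, all numbers written in binary. Here an algorithm is a program of a first-order language of recursive functions on data built from natural numbers by pairing, evaluated call by value. A pointer operation (access to a variable, pairing, projection, zero test, binding, function call) costs one step; addition and truncated subtraction are the only arithmetic operations, and each costs as many steps as its operands have bits, plus one (and, for a numeric literal, one plus its number of bits). -/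

import Mathlib

/-! ## Directed Power Vertex Cover -/

namespace DPVC

/-- An instance graph of Directed Power Vertex Cover: a finite simple graph on the vertices
`0, …, n - 1`, and for every edge `uv` two positive integer demands, `w u v` (the power that `u`
needs to cover the edge) and `w v u` (the power that `v` needs to cover it).
The values of `w` outside the edges carry no meaning. -/
structure Inst where
  n : ℕ
  G : SimpleGraph (Fin n)
  w : Fin n → Fin n → ℕ
  w_pos : ∀ u v, G.Adj u v → 0 < w u v

/-- A power assignment is feasible if every edge is covered by one of its endpoints. -/
def Inst.Feasible (I : Inst) (p : Fin I.n → ℕ) : Prop :=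
  ∀ u v, I.G.Adj u v → I.w u v ≤ p u ∨ I.w v u ≤ p v

/-- The decision problem: is there a feasible solution of total power at most `P`? -/
def Inst.Solvable (I : Inst) (P : ℕ) : Prop :=
  ∃ p : Fin I.n → ℕ, I.Feasible p ∧ ∑ v, p v ≤ P

end DPVC

/-! ## The model of computation

Algorithms are programs of a first-order language of recursive functions on data that are built
from natural numbers by pairing. Evaluation is call by value and comes with a step count. An
operation on pointers (reading a variable, pairing, projecting, testing, binding, calling) takes one
step, and arithmetic (addition and truncated subtraction only) takes time linear in the number of
bits of the operands. -/

namespace Cost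

/-- The data: natural numbers and pairs. -/
inductive Val where
  | num (k : ℕ)
  | pair (a b : Val)

/-- The number of bits and pairing cells of a datum, up to a constant factor. -/
def Val.size : Val → ℕ
  | .num k => 1 + Nat.size k
  | .pair a b => 1 + a.size + b.size

/-- Lists are coded as usual, with the number `0` as the empty list. -/
def Val.ofList : List Val → Val
  | [] => .num 0
  | a :: l => .pair a (Val.ofList l)

/-- Expressions. Variables are de Bruijn indices into the environment;
`ifz c a b` is `a` if `c` is the number `0`, and `b` otherwise;
`bind a b` is `let x := a in b`; `call f a` applies the `f`-th function of the program to `a`. -/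
inductive Exp where
  | var (i : ℕ)
  | lit (k : ℕ)
  | add (a b : Exp)
  | sub (a b : Exp)
  | pair (a b : Exp)
  | fst (a : Exp)
  | snd (a : Exp)
  | ifz (c a b : Exp)
  | bind (a b : Exp)
  | call (f : ℕ) (a : Exp)

/-- A program is a finite list of (mutually recursive) functions of one argument, given by their
bodies; function number `0` is the main function. -/
abbrev Prog := List Exp

/-- `Eval p env e v t`: in the program `p` and the environment `env`, the expression `e` evaluates
to `v` in exactly `t` steps. -/
inductive Eval (p : Prog) : List Val → Exp → Val → ℕ → Prop where
  | var {env : List Val} {i : ℕ} {v : Val} (h : env[i]? = some v) :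
      Eval p env (.var i) v 1
  | lit {env : List Val} {k : ℕ} :
      Eval p env (.lit k) (.num k) (1 + Nat.size k)
  | add {env : List Val} {a b : Exp} {x y s t : ℕ}
      (ha : Eval p env a (.num x) s) (hb : Eval p env b (.num y) t) :
      Eval p env (.add a b) (.num (x + y)) (s + t + (1 + Nat.size x + Nat.size y))
  | sub {env : List Val} {a b : Exp} {x y s t : ℕ}
      (ha : Eval p env a (.num x) s) (hb : Eval p env b (.num y) t) :
      Eval p env (.sub a b) (.num (x - y)) (s + t + (1 + Nat.size x + Nat.size y))
  | pair {env : List Val} {a b : Exp} {x y : Val} {s t : ℕ}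
      (ha : Eval p env a x s) (hb : Eval p env b y t) :
      Eval p env (.pair a b) (.pair x y) (s + t + 1)
  | fst {env : List Val} {a : Exp} {x y : Val} {s : ℕ}
      (ha : Eval p env a (.pair x y) s) :
      Eval p env (.fst a) x (s + 1)
  | snd {env : List Val} {a : Exp} {x y : Val} {s : ℕ}
      (ha : Eval p env a (.pair x y) s) :
      Eval p env (.snd a) y (s + 1)
  | ifz_zero {env : List Val} {c a b : Exp} {v : Val} {s t : ℕ}
      (hc : Eval p env c (.num 0) s) (ha : Eval p env a v t) :
      Eval p env (.ifz c a b) v (s + t + 1)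
  | ifz_nonzero {env : List Val} {c a b : Exp} {x v : Val} {s t : ℕ}
      (hc : Eval p env c x s) (hx : x ≠ .num 0) (hb : Eval p env b v t) :
      Eval p env (.ifz c a b) v (s + t + 1)
  | bind {env : List Val} {a b : Exp} {x v : Val} {s t : ℕ}
      (ha : Eval p env a x s) (hb : Eval p (x :: env) b v t) :
      Eval p env (.bind a b) v (s + t + 1)
  | call {env : List Val} {f : ℕ} {a body : Exp} {x v : Val} {s t : ℕ}
      (ha : Eval p env a x s) (hf : p[f]? = some body) (hb : Eval p [x] body v t) :
      Eval p env (.call f a) v (s + t + 1)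

/-- The model is deterministic: the value and the number of steps are determined. -/
theorem Eval.det {p : Prog} {env : List Val} {e : Exp} {v v' : Val} {t t' : ℕ}
    (h : Eval p env e v t) (h' : Eval p env e v' t') : v = v' ∧ t = t' := by
  induction h generalizing v' t' with
  | var h => cases h' with | var h2 => simp_all
  | lit => cases h' with | lit => simp
  | add _ _ iha ihb =>
    cases h' with
    | add ha hb => have := iha ha; have := ihb hb; simp_all
  | sub _ _ iha ihb =>
    cases h' with
    | sub ha hb => have := iha ha; have := ihb hb; simp_all
  | pair _ _ iha ihb =>
    cases h' with
    | pair ha hb => have := iha ha; have := ihb hb; simp_all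
  | fst _ iha => cases h' with | fst ha => have := iha ha; simp_all
  | snd _ iha => cases h' with | snd ha => have := iha ha; simp_all
  | ifz_zero _ _ ihc iha =>
    cases h' with
    | ifz_zero hc ha => have := ihc hc; have := iha ha; simp_all
    | ifz_nonzero hc hx hb => exact absurd (ihc hc).1.symm hx
  | ifz_nonzero _ hx _ ihc ihb =>
    cases h' with
    | ifz_zero hc ha => exact absurd (ihc hc).1 hx
    | ifz_nonzero hc hx hb => have := ihc hc; have := ihb hb; simp_all
  | bind _ _ iha ihb =>
    cases h' with
    | bind ha hb =>
      obtain ⟨rfl, rfl⟩ := iha ha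
      have := ihb hb
      simp_all
  | call _ hf _ iha ihb =>
    cases h' with
    | call ha hf' hb =>
      obtain ⟨rfl, rfl⟩ := iha ha
      obtain rfl := Option.some.inj (hf.symm.trans hf')
      have := ihb hb
      simp_all

/-- On the given input, the main function of `p` halts with the given output after `t` steps. -/
def Prog.Outputs (p : Prog) (input output : Val) (t : ℕ) : Prop :=
  Eval p [input] (.call 0 (.var 0)) output t

end Cost

namespace DPVC

open Cost

open Classical in
/-- The input of an algorithm for Directed Power Vertex Cover: the `n × n` matrix of demands, as a
list of rows, with entry `0` where there is no edge, together with the bound `P` in binary. -/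
noncomputable def Inst.encode (I : Inst) (P : ℕ) : Val :=
  .pair
    (Val.ofList (List.ofFn fun u => Val.ofList (List.ofFn fun v =>
      .num (if I.G.Adj u v then I.w u v else 0))))
    (.num P)

/-- The answers: `1` for YES and `0` for NO. -/
def answer : Bool → Val
  | true => .num 1
  | false => .num 0

end DPVC

set_option linter.unusedSectionVars false

/-! Replace every vertex u by copies (u,0), …, (u,P), and for an edge uv join (u,i) to (v,j)
whenever i is below the demand at u and j below the demand at v. Each edge thus becomes a complete
bipartite graph, so a vertex cover must contain one of its sides entirely; the number of chosen
copies of u serves as the power of u. Stopping at P+1 copies is harmless, since a cover of size at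
most P never contains P+1 copies of one vertex. Hence DPVC with bound P is Vertex Cover with budget
P (`Inst.tau_graph_le_iff`), on a graph whose size is polynomial in the input size and P.

Vertex Cover is solved by a search tree. A branching is a list of vertex sets such that some optimal
cover contains one of them. The basic one is: N(x), or else two neighbours of x stay outside the
cover and force their own neighbourhoods into it. Local rules for degrees 1, 2, 3 and at least 5
decrease the budget by amounts whose worst vectors are (1,5) and (2,3). Both have the root ρ =
1.3247… of ρ³ = ρ + 1. The slightly larger base 1.3249 leaves a slack of 1/5000 in every rule
(`isBranching_of_mem_rules`).

If no rule applies, all degrees are 3 or 4 and neighbours of degree-3 vertices have degree 3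
(`nbr_length_three_of_rules_eq_nil`), so each component is 3- or 4-regular. A disconnected graph is
split; a connected one is branched on at any vertex. The latter is expensive, but no proper subgraph
of a connected d-regular graph obtained by deleting vertices has a d-regular component again
(`lev_del`). So such a branching occurs at most twice on a path of the tree and costs only a
polynomial factor, recorded in `coef`. `nodes_expand` sums this up: the tree has at most
polynomially many times 1.3249^P nodes.

On the machine side, `PolyF` is a compositional calculus of polynomial-time functions, which shows
that a node is expanded in polynomial time (`polyF_expand`). `Search.eval_solve` converts the bound
on the number of nodes into a bound on steps. Finally the factor polynomial in P is absorbed by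
passing from 1.3249 to 1.325. -/

namespace Cost

/-! ## Polynomial-time functions of the model -/

/-- A coding of the elements of a type as data. -/
class Enc (α : Type) where
  enc : α → Val

open Enc

instance : Enc ℕ := ⟨Val.num⟩

/-- The code 0 of `false` is the value that `ifz` tests for, so coded Booleans serve directly as
conditions. -/
instance : Enc Bool := ⟨fun b => .num b.toNat⟩

instance {α β : Type} [Enc α] [Enc β] : Enc (α × β) := ⟨fun x => .pair (enc x.1) (enc x.2)⟩

instance {α : Type} [Enc α] : Enc (List α) := ⟨fun l => Val.ofList (l.map enc)⟩

/-- The size of the code of an element. -/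
def sz {α : Type} [Enc α] (a : α) : ℕ := (enc a).size

/-! ### Sizes of codes -/

section Sizes

variable {α β : Type} [Enc α] [Enc β]

@[simp] theorem enc_nat (k : ℕ) : enc k = Val.num k := rfl
@[simp] theorem enc_bool (b : Bool) : enc b = Val.num b.toNat := rfl
@[simp] theorem enc_prod (x : α × β) : enc x = Val.pair (enc x.1) (enc x.2) := rfl
@[simp] theorem enc_nil : enc ([] : List α) = Val.num 0 := rfl
@[simp] theorem enc_cons (a : α) (l : List α) : enc (a :: l) = Val.pair (enc a) (enc l) := rfl

@[simp] theorem sz_nat (k : ℕ) : sz k = 1 + Nat.size k := rfl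
@[simp] theorem sz_prod (x : α × β) : sz x = 1 + sz x.1 + sz x.2 := rfl
@[simp] theorem sz_nil : sz ([] : List α) = 1 := rfl
@[simp] theorem sz_cons (a : α) (l : List α) : sz (a :: l) = 1 + sz a + sz l := rfl

theorem sz_bool (b : Bool) : sz b ≤ 2 := by cases b <;> decide

theorem sz_pos (a : α) : 1 ≤ sz a := by
  unfold sz
  cases enc a <;> simp [Val.size]; omega

theorem length_lt_sz (l : List α) : l.length < sz l := by
  induction l with
  | nil => simp
  | cons a l ih => simp; omega

theorem sz_append (l l' : List α) : sz (l ++ l') ≤ sz l + sz l' := by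
  induction l with
  | nil => simp
  | cons a l ih => simp; omega

theorem sz_sublist {l l' : List α} (h : l.Sublist l') : sz l ≤ sz l' := by
  induction h with
  | slnil => simp
  | cons a _ ih => simp; omega
  | cons_cons a _ ih => simp; omega

theorem sz_mem {l : List α} {a : α} (h : a ∈ l) : sz a < sz l := by
  induction l with
  | nil => simp at h
  | cons b l ih =>
    rcases List.mem_cons.1 h with rfl | h
    · simp; omega
    · have := ih h; simp; omega

theorem sz_le_of_forall {l : List α} {n m : ℕ} (hl : l.length ≤ n) (h : ∀ a ∈ l, sz a ≤ m) :
    sz l ≤ 1 + n * (1 + m) := by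
  induction l generalizing n with
  | nil => simp
  | cons a l ih =>
    obtain ⟨n, rfl⟩ : ∃ k, n = k + 1 := ⟨n - 1, by simp at hl; omega⟩
    have h1 := ih (n := n) (by simpa using hl) fun b hb => h b (by simp [hb])
    have h2 := h a (by simp)
    simp only [sz_cons, Nat.add_mul]; omega

end Sizes

theorem size_add_le (x y : ℕ) : Nat.size (x + y) ≤ 1 + Nat.size x + Nat.size y := by
  rw [Nat.size_le]
  have hx := Nat.lt_size_self x
  have hy := Nat.lt_size_self y
  have h1 : 2 ^ Nat.size x ≤ 2 ^ (Nat.size x + Nat.size y) :=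
    Nat.pow_le_pow_right (by norm_num) (by omega)
  have h2 : 2 ^ Nat.size y ≤ 2 ^ (Nat.size x + Nat.size y) :=
    Nat.pow_le_pow_right (by norm_num) (by omega)
  rw [Nat.add_assoc, Nat.pow_add]; omega

theorem size_le_self (x : ℕ) : Nat.size x ≤ x := by
  rw [Nat.size_le]; exact Nat.lt_two_pow_self

/-- Coefficients in ℕ make every polynomial monotone, so bounds can be substituted into one another
without side conditions. -/
theorem eval_mono (q : Polynomial ℕ) {m n : ℕ} (h : m ≤ n) : q.eval m ≤ q.eval n := by
  simp only [Polynomial.eval_eq_sum, Polynomial.sum]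
  gcongr

/-- The program `p` contains the list of functions `ext` from position `n` on. -/
def Has (p : Prog) (n : ℕ) (ext : List Exp) : Prop :=
  ∀ i < ext.length, p[n + i]? = ext[i]?

theorem Has.left {p : Prog} {n : ℕ} {e e' : List Exp} (h : Has p n (e ++ e')) : Has p n e := by
  intro i hi
  rw [h i (by simp; omega), List.getElem?_append_left hi]

theorem Has.right {p : Prog} {n : ℕ} {e e' : List Exp} (h : Has p n (e ++ e')) :
    Has p (n + e.length) e' := by
  intro i hi
  have := h (e.length + i) (by simp; omega)
  rw [Nat.add_assoc, this, List.getElem?_append_right (by omega)]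
  simp

theorem Has.head {p : Prog} {n : ℕ} {b : Exp} {e : List Exp} (h : Has p n (b :: e)) :
    p[n]? = some b := by
  simpa using h 0 (by simp)

/-- `f` is computed, within a polynomial number of steps and with an output of polynomial size, by
an expression that uses auxiliary functions which can be placed anywhere in a program. -/
def PolyF {α β : Type} [Enc α] [Enc β] (f : α → β) : Prop :=
  ∃ q : Polynomial ℕ, ∀ n : ℕ, ∃ (ext : List Exp) (code : Exp), ∀ p : Prog, Has p n ext →
    ∀ (a : α) (env : List Val), ∃ t, Eval p (enc a :: env) code (enc (f a)) t ∧
      t ≤ q.eval (sz a) ∧ sz (f a) ≤ q.eval (sz a)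

namespace PolyF

variable {α β γ δ : Type} [Enc α] [Enc β] [Enc γ] [Enc δ]

/-- The size bound does not mention the program; it is extracted by taking the auxiliary functions
themselves, placed at position 0, as the program. -/
theorem size_bound {f : α → β} (hf : PolyF f) :
    ∃ q : Polynomial ℕ, ∀ a, sz (f a) ≤ q.eval (sz a) := by
  obtain ⟨q, hq⟩ := hf
  obtain ⟨ext, code, h⟩ := hq 0
  refine ⟨q, fun a => ?_⟩
  obtain ⟨t, -, -, h⟩ := h ext (fun i _ => by simp) a []
  exact h

theorem congr {f g : α → β} (hf : PolyF f) (h : ∀ a, g a = f a) : PolyF g := by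
  rwa [show g = f from funext h]

protected theorem id : PolyF (fun a : α => a) :=
  ⟨.X + 1, fun _ => ⟨[], .var 0, fun p _ a env => ⟨1, .var (by simp), by simp, by simp⟩⟩⟩

theorem fst : PolyF (fun x : α × β => x.1) :=
  ⟨.X + 2, fun _ => ⟨[], .fst (.var 0), fun p _ a env =>
    ⟨2, .fst (y := enc a.2) (.var (by simp)), by simp, by simp; omega⟩⟩⟩

theorem snd : PolyF (fun x : α × β => x.2) :=
  ⟨.X + 2, fun _ => ⟨[], .snd (.var 0), fun p _ a env =>
    ⟨2, .snd (x := enc a.1) (.var (by simp)), by simp, by simp; omega⟩⟩⟩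

theorem exists_code (v : Val) : ∃ (e : Exp) (t : ℕ), ∀ p env, Eval p env e v t := by
  induction v with
  | num k => exact ⟨.lit k, _, fun p env => .lit⟩
  | pair a b iha ihb =>
    obtain ⟨ea, ta, ha⟩ := iha
    obtain ⟨eb, tb, hb⟩ := ihb
    exact ⟨.pair ea eb, _, fun p env => .pair (ha p env) (hb p env)⟩

theorem const (b : β) : PolyF (fun _ : α => b) := by
  obtain ⟨e, t, h⟩ := exists_code (enc b)
  exact ⟨.C (t + sz b), fun _ => ⟨[], e, fun p _ a env => ⟨t, h p _, by simp, by simp⟩⟩⟩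

theorem comp {g : β → γ} {f : α → β} (hg : PolyF g) (hf : PolyF f) :
    PolyF (fun a => g (f a)) := by
  obtain ⟨q, hq⟩ := hf
  obtain ⟨r, hr⟩ := hg
  refine ⟨q + r.comp q + 1, fun n => ?_⟩
  obtain ⟨e, c, h⟩ := hq n
  obtain ⟨e', c', h'⟩ := hr (n + e.length)
  refine ⟨e ++ e', .bind c c', fun p hp a env => ?_⟩
  obtain ⟨t, h1, h2, h3⟩ := h p hp.left a env
  obtain ⟨t', h1', h2', h3'⟩ := h' p hp.right (f a) (enc a :: env)
  have := eval_mono r h3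
  refine ⟨_, .bind h1 h1', ?_, ?_⟩ <;> simp <;> omega

theorem pair {f : α → β} {g : α → γ} (hf : PolyF f) (hg : PolyF g) :
    PolyF (fun a => (f a, g a)) := by
  obtain ⟨q, hq⟩ := hf
  obtain ⟨r, hr⟩ := hg
  refine ⟨q + r + 1, fun n => ?_⟩
  obtain ⟨e, c, h⟩ := hq n
  obtain ⟨e', c', h'⟩ := hr (n + e.length)
  refine ⟨e ++ e', .pair c c', fun p hp a env => ?_⟩
  obtain ⟨t, h1, h2, h3⟩ := h p hp.left a env
  obtain ⟨t', h1', h2', h3'⟩ := h' p hp.right a env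
  refine ⟨_, .pair h1 h1', ?_, ?_⟩ <;> simp <;> omega

theorem cons {f : α → β} {g : α → List β} (hf : PolyF f) (hg : PolyF g) :
    PolyF (fun a => f a :: g a) := hf.pair hg

theorem natAdd {f g : α → ℕ} (hf : PolyF f) (hg : PolyF g) : PolyF (fun a => f a + g a) := by
  obtain ⟨q, hq⟩ := hf
  obtain ⟨r, hr⟩ := hg
  refine ⟨2 * q + 2 * r + 2, fun n => ?_⟩
  obtain ⟨e, c, h⟩ := hq n
  obtain ⟨e', c', h'⟩ := hr (n + e.length)
  refine ⟨e ++ e', .add c c', fun p hp a env => ?_⟩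
  obtain ⟨t, h1, h2, h3⟩ := h p hp.left a env
  obtain ⟨t', h1', h2', h3'⟩ := h' p hp.right a env
  have := size_add_le (f a) (g a)
  simp only [sz_nat] at h3 h3'
  refine ⟨_, .add h1 h1', ?_, ?_⟩ <;> simp <;> omega

theorem natSub {f g : α → ℕ} (hf : PolyF f) (hg : PolyF g) : PolyF (fun a => f a - g a) := by
  obtain ⟨q, hq⟩ := hf
  obtain ⟨r, hr⟩ := hg
  refine ⟨2 * q + 2 * r + 2, fun n => ?_⟩
  obtain ⟨e, c, h⟩ := hq n
  obtain ⟨e', c', h'⟩ := hr (n + e.length)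
  refine ⟨e ++ e', .sub c c', fun p hp a env => ?_⟩
  obtain ⟨t, h1, h2, h3⟩ := h p hp.left a env
  obtain ⟨t', h1', h2', h3'⟩ := h' p hp.right a env
  have := Nat.size_le_size (Nat.sub_le (f a) (g a))
  simp only [sz_nat] at h3 h3'
  refine ⟨_, .sub h1 h1', ?_, ?_⟩ <;> simp <;> omega

theorem cond {c : α → Bool} {f g : α → β} (hc : PolyF c) (hf : PolyF f) (hg : PolyF g) :
    PolyF (fun a => bif c a then f a else g a) := by
  obtain ⟨q, hq⟩ := hc
  obtain ⟨r, hr⟩ := hf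
  obtain ⟨s, hs⟩ := hg
  refine ⟨q + r + s + 1, fun n => ?_⟩
  obtain ⟨e, x, h⟩ := hq n
  obtain ⟨e', x', h'⟩ := hr (n + e.length)
  obtain ⟨e'', x'', h''⟩ := hs (n + (e ++ e').length)
  -- The branches are swapped: `ifz` takes its first branch on 0, the code of `false`.
  refine ⟨e ++ e' ++ e'', .ifz x x'' x', fun p hp a env => ?_⟩
  obtain ⟨t, h1, h2, h3⟩ := h p hp.left.left a env
  obtain ⟨t', h1', h2', h3'⟩ := h' p hp.left.right a env
  obtain ⟨t'', h1'', h2'', h3''⟩ := h'' p hp.right a env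
  cases hca : c a with
  | false =>
    simp only [hca, enc_bool, Bool.toNat_false, cond_false] at h1 ⊢
    refine ⟨_, .ifz_zero h1 h1'', ?_, ?_⟩ <;> simp <;> omega
  | true =>
    simp only [hca, enc_bool, Bool.toNat_true, cond_true] at h1 ⊢
    refine ⟨_, .ifz_nonzero h1 (by simp) h1', ?_, ?_⟩ <;> simp <;> omega

theorem natIsZero {f : α → ℕ} (hf : PolyF f) : PolyF (fun a => decide (f a = 0)) := by
  refine comp (g := fun k : ℕ => decide (k = 0)) ?_ hf
  refine ⟨7, fun _ => ⟨[], .ifz (.var 0) (.lit 1) (.lit 0), fun p _ k env => ?_⟩⟩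
  by_cases hk : k = 0
  · subst hk
    exact ⟨_, .ifz_zero (.var (by simp)) .lit, by simp, (sz_bool _).trans (by simp)⟩
  · simp only [hk, decide_false]
    exact ⟨_, .ifz_nonzero (x := .num k) (.var (by simp)) (by simpa using hk) .lit, by simp,
      (sz_bool _).trans (by simp)⟩

/-- Recursion on a list is in polynomial time if all intermediate results have polynomial size. -/
theorem foldr {l : α → List β} {b : α → γ} {g : α → β → γ → γ} (hl : PolyF l) (hb : PolyF b)
    (hg : PolyF (fun x : α × β × γ => g x.1 x.2.1 x.2.2))
    (hr : ∃ r : Polynomial ℕ, ∀ a l', l' <:+ l a → sz (l'.foldr (g a) (b a)) ≤ r.eval (sz a)) :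
    PolyF (fun a => (l a).foldr (g a) (b a)) := by
  obtain ⟨ql, hl⟩ := hl
  obtain ⟨qb, hb⟩ := hb
  obtain ⟨qg, hg⟩ := hg
  obtain ⟨r, hr⟩ := hr
  -- one round costs at most `20 + qg (…)`
  let w : Polynomial ℕ := 20 + qg.comp (.X + ql + r + 2)
  refine ⟨ql + qb + ql * w + w + r + 20, fun n => ?_⟩
  obtain ⟨el, cl, hl⟩ := hl n
  obtain ⟨eb, cb, hb⟩ := hb (n + el.length)
  obtain ⟨eg, cg, hg⟩ := hg (n + (el ++ eb).length)
  let F : ℕ := n + (el ++ eb ++ eg).length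
  -- The recursive function `F` takes the pair of the remaining list and `a`: a function body sees
  -- only its argument, so `a` has to be passed along. In the second case `cg` runs on the triple of
  -- `a`, the head and the result for the tail.
  let body : Exp := .ifz (.fst (.var 0)) (.bind (.snd (.var 0)) cb)
    (.bind (.pair (.snd (.var 0)) (.pair (.fst (.fst (.var 0)))
      (.call F (.pair (.snd (.fst (.var 0))) (.snd (.var 0)))))) cg)
  refine ⟨el ++ eb ++ eg ++ [body], .call F (.pair cl (.var 0)), fun p hp a env => ?_⟩
  have hF : p[F]? = some body := hp.right.head
  have main : ∀ l', l' <:+ l a → ∃ t, Eval p [.pair (enc l') (enc a)] body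
      (enc (l'.foldr (g a) (b a))) t ∧
      t ≤ l'.length * w.eval (sz a) + qb.eval (sz a) + 8 := by
    intro l'
    induction l' with
    | nil =>
      intro _
      obtain ⟨t, h1, h2, -⟩ := hb p hp.left.left.right a [.pair (.num 0) (enc a)]
      refine ⟨_, .ifz_zero (.fst (y := enc a) (.var (by simp)))
        (.bind (.snd (x := .num 0) (.var (by simp))) h1), ?_⟩
      simp; omega
    | cons x l' ih =>
      intro hs
      have hs' : l' <:+ l a := (List.suffix_cons x l').trans hs
      obtain ⟨t, h1, h2⟩ := ih hs'
      have hx : sz x < sz (l a) := sz_mem (hs.subset (by simp))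
      obtain ⟨-, -, -, hla⟩ := hl p hp.left.left.left a []
      have hra := hr a l' hs'
      obtain ⟨t', h1', h2', -⟩ := hg p hp.left.right (a, x, l'.foldr (g a) (b a))
        [.pair (enc (x :: l')) (enc a)]
      -- This is where the polynomial size of intermediate results enters: the cost of a round
      -- depends on the result for the tail.
      have hm : qg.eval (sz (a, x, l'.foldr (g a) (b a))) ≤
          qg.eval (sz a + ql.eval (sz a) + r.eval (sz a) + 2) := by
        apply eval_mono; simp; omega
      have hv : ∀ e : List Val, (Val.pair (enc (x :: l')) (enc a) :: e)[0]? =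
        some (Val.pair (.pair (enc x) (enc l')) (enc a)) := fun e => by simp
      refine ⟨_, .ifz_nonzero (.fst (.var (hv _))) (by simp) (.bind (.pair (.snd (.var (hv _)))
        (.pair (.fst (.fst (.var (hv _)))) (.call (.pair (.snd (.fst (.var (hv _))))
          (.snd (.var (hv _)))) hF h1))) h1'), ?_⟩
      have hw : w.eval (sz a) = 20 + qg.eval (sz a + ql.eval (sz a) + r.eval (sz a) + 2) := by
        simp [w]
      simp only [List.length_cons, Nat.add_mul]; omega
  obtain ⟨t, h1, h2, h3⟩ := hl p hp.left.left.left a env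
  obtain ⟨t', h1', h2'⟩ := main (l a) List.suffix_rfl
  refine ⟨_, .call (.pair h1 (.var (by simp))) hF h1', ?_, ?_⟩
  · have hlen : (l a).length ≤ ql.eval (sz a) := (length_lt_sz _).le.trans h3
    have := Nat.mul_le_mul_right (w.eval (sz a)) hlen
    simp only [Polynomial.eval_add, Polynomial.eval_mul, Polynomial.eval_ofNat]; omega
  · have := hr a (l a) List.suffix_rfl
    simp only [Polynomial.eval_add, Polynomial.eval_mul, Polynomial.eval_ofNat]; omega

end PolyF
end Cost

/-! ### Polynomial-time Boolean, arithmetic and list operations -/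

namespace Cost

open Enc

namespace PolyF

variable {α β γ δ : Type} [Enc α] [Enc β] [Enc γ] [Enc δ]

theorem not {c : α → Bool} (hc : PolyF c) : PolyF (fun a => !c a) :=
  (hc.cond (const false) (const true)).congr fun a => by cases c a <;> rfl

theorem and {c d : α → Bool} (hc : PolyF c) (hd : PolyF d) : PolyF (fun a => c a && d a) :=
  (hc.cond hd (const false)).congr fun a => by cases c a <;> rfl

theorem or {c d : α → Bool} (hc : PolyF c) (hd : PolyF d) : PolyF (fun a => c a || d a) :=
  (hc.cond (const true) hd).congr fun a => by cases c a <;> rfl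

theorem natLe {f g : α → ℕ} (hf : PolyF f) (hg : PolyF g) :
    PolyF (fun a => decide (f a ≤ g a)) :=
  (hf.natSub hg).natIsZero.congr fun a => by simp [Nat.sub_eq_zero_iff_le]

theorem natLt {f g : α → ℕ} (hf : PolyF f) (hg : PolyF g) :
    PolyF (fun a => decide (f a < g a)) :=
  (hg.natLe hf).not.congr fun a => by rw [Bool.eq_iff_iff]; simp

theorem natEq {f g : α → ℕ} (hf : PolyF f) (hg : PolyF g) :
    PolyF (fun a => decide (f a = g a)) :=
  ((hf.natLe hg).and (hg.natLe hf)).congr fun a => by simp [le_antisymm_iff]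

theorem append {f g : α → List β} (hf : PolyF f) (hg : PolyF g) :
    PolyF (fun a => f a ++ g a) := by
  have key : ∀ l l' : List β, l.foldr (fun x r => x :: r) l' = l ++ l' := fun l l' => by simp
  refine (foldr (g := fun _ x r => x :: r) hf hg
    ((fst.comp snd).cons (snd.comp snd)) ?_).congr fun a => (key _ _).symm
  obtain ⟨q, hq⟩ := hf.size_bound
  obtain ⟨r, hr⟩ := hg.size_bound
  refine ⟨q + r, fun a l' h => ?_⟩
  have h1 := sz_append l' (g a)
  have h2 := sz_sublist h.sublist
  have h3 := hq a
  have h4 := hr a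
  rw [key, Polynomial.eval_add]; omega

theorem flatMap {l : α → List β} {g : α → β → List γ} (hl : PolyF l)
    (hg : PolyF (fun x : α × β => g x.1 x.2)) : PolyF (fun a => (l a).flatMap (g a)) := by
  have key : ∀ (f : β → List γ) (l : List β), l.foldr (fun x r => f x ++ r) [] = l.flatMap f := by
    intro f l; induction l with
    | nil => rfl
    | cons x l ih => simp [ih]
  refine (foldr (b := fun _ => []) (g := fun a x r => g a x ++ r) hl (const [])
    ((hg.comp (fst.pair (fst.comp snd))).append (snd.comp snd)) ?_).congr
    fun a => (key _ _).symm
  obtain ⟨q, hq⟩ := hl.size_bound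
  obtain ⟨r, hr⟩ := hg.size_bound
  refine ⟨1 + q * r.comp (1 + .X + q), fun a l' h => ?_⟩
  rw [key]
  have h0 : ∀ x ∈ l a, sz (g a x) ≤ r.eval (1 + sz a + q.eval (sz a)) := by
    intro x hx
    refine (hr (a, x)).trans (eval_mono _ ?_)
    have := sz_mem hx
    have := hq a
    simp; omega
  have h1 : ∀ l' : List β, (∀ x ∈ l', x ∈ l a) → sz (l'.flatMap (g a)) ≤
      1 + l'.length * r.eval (1 + sz a + q.eval (sz a)) := by
    intro l'
    induction l' with
    | nil => simp
    | cons x l' ih =>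
      intro hs
      have := ih fun y hy => hs y (by simp [hy])
      have := h0 x (hs x (by simp))
      have := sz_append (g a x) (l'.flatMap (g a))
      simp only [List.flatMap_cons, List.length_cons, Nat.add_mul]; omega
  refine (h1 l' h.subset).trans ?_
  have h2 : l'.length ≤ q.eval (sz a) :=
    h.length_le.trans ((length_lt_sz _).le.trans (hq a))
  simp only [Polynomial.eval_add, Polynomial.eval_mul, Polynomial.eval_one, Polynomial.eval_comp,
    Polynomial.eval_X]
  gcongr

theorem singleton {f : α → β} (hf : PolyF f) : PolyF (fun a => [f a]) := hf.cons (const [])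

theorem map {l : α → List β} {g : α → β → γ} (hl : PolyF l)
    (hg : PolyF (fun x : α × β => g x.1 x.2)) : PolyF (fun a => (l a).map (g a)) :=
  (hl.flatMap (g := fun a x => [g a x]) hg.singleton).congr
    fun _ => List.map_eq_flatMap

theorem filter {l : α → List β} {p : α → β → Bool} (hl : PolyF l)
    (hp : PolyF (fun x : α × β => p x.1 x.2)) : PolyF (fun a => (l a).filter (p a)) :=
  (hl.flatMap (g := fun a x => bif p a x then [x] else []) (hp.cond snd.singleton (const []))).congr
    fun a => by
      induction l a with
      | nil => rfl
      | cons x l ih => cases h : p a x <;> simp [h, ih]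

theorem any {l : α → List β} {p : α → β → Bool} (hl : PolyF l)
    (hp : PolyF (fun x : α × β => p x.1 x.2)) : PolyF (fun a => (l a).any (p a)) :=
  (foldr (b := fun _ => false) (g := fun a x r => p a x || r) hl (const false)
    ((hp.comp (fst.pair (fst.comp snd))).or (snd.comp snd))
    ⟨2, fun _ _ _ => (sz_bool _).trans (by simp)⟩).congr fun a => by
      induction l a with
      | nil => rfl
      | cons x l ih => simp [ih]

theorem length {l : α → List β} (hl : PolyF l) : PolyF (fun a => (l a).length) := by
  have key : ∀ l : List β, l.foldr (fun _ r => r + 1) 0 = l.length := by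
    intro l; induction l with
    | nil => rfl
    | cons x l ih => simp
  refine (foldr (b := fun _ => 0) (g := fun _ _ r => r + 1) hl (const 0)
    ((snd.comp snd).natAdd (const 1)) ?_).congr fun a => (key _).symm
  obtain ⟨q, hq⟩ := hl.size_bound
  refine ⟨q, fun a l' h => ?_⟩
  rw [key, sz_nat]
  have := size_le_self l'.length
  have := length_lt_sz l'
  have := sz_sublist h.sublist
  have := hq a
  omega

theorem isEmpty {l : α → List β} (hl : PolyF l) : PolyF (fun a => (l a).isEmpty) :=
  hl.length.natIsZero.congr fun a => by cases l a <;> simp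

theorem headD {l : α → List β} (hl : PolyF l) (d : β) : PolyF (fun a => (l a).headD d) := by
  have key : ∀ l : List β, l.foldr (fun x _ => x) d = l.headD d := by
    intro l; cases l <;> rfl
  refine (foldr (b := fun _ => d) (g := fun _ x _ => x) hl (const d)
    (fst.comp snd) ?_).congr fun a => (key _).symm
  obtain ⟨q, hq⟩ := hl.size_bound
  refine ⟨q + .C (sz d), fun a l' h => ?_⟩
  rw [key]
  have := hq a
  cases l' with
  | nil => simp
  | cons x l' =>
    have := sz_mem (h.subset (List.mem_cons_self (a := x) (l := l')))
    simp; omega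

/-- A right fold meets the last element first, so the index of an element is recovered as the length
of the whole list minus one minus the number of elements already processed. -/
theorem zipIdx {l : α → List β} (hl : PolyF l) : PolyF (fun a => (l a).zipIdx) := by
  have key : ∀ l l' : List β, l' <:+ l →
      l'.foldr (fun x r => (x, l.length - 1 - r.length) :: r) [] =
        l'.zipIdx (l.length - l'.length) := by
    intro l l'
    induction l' with
    | nil => simp
    | cons x l' ih =>
      intro h
      have h1 := h.length_le
      simp only [List.length_cons] at h1
      rw [List.foldr_cons, ih ((List.suffix_cons x l').trans h)]
      simp only [List.length_zipIdx, List.zipIdx_cons, List.length_cons]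
      congr 2
      · omega
      · omega
  refine (foldr (b := fun _ => ([] : List (β × ℕ)))
    (g := fun a x r => (x, (l a).length - 1 - r.length) :: r) hl (const [])
    (((fst.comp snd).pair (((hl.comp fst).length.natSub (const 1)).natSub
      (snd.comp snd).length)).cons (snd.comp snd)) ?_).congr fun a => by
        rw [key _ _ List.suffix_rfl, Nat.sub_self]
  obtain ⟨q, hq⟩ := hl.size_bound
  refine ⟨1 + q * (1 + (2 + 2 * q)), fun a l' h => ?_⟩
  rw [key _ _ h]
  have h1 := hq a
  have h2 := length_lt_sz (l a)
  have h3 := h.length_le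
  have h4 := sz_le_of_forall (l := l'.zipIdx ((l a).length - l'.length)) (n := q.eval (sz a))
    (m := 2 + 2 * q.eval (sz a)) (by simp; omega) ?_
  · simpa using h4
  · rintro ⟨x, i⟩ hx
    have h5 := sz_mem (h.subset (List.fst_mem_of_mem_zipIdx hx))
    have h6 := List.snd_lt_of_mem_zipIdx hx
    have h7 := size_le_self i
    simp only [sz_prod, sz_nat] at h5 ⊢
    omega

section DecEq

variable [DecidableEq β]

theorem mem {f : α → β} {l : α → List β}
    (he : PolyF (fun x : β × β => decide (x.1 = x.2))) (hf : PolyF f) (hl : PolyF l) :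
    PolyF (fun a => decide (f a ∈ l a)) :=
  (hl.any (p := fun a x => decide (f a = x)) (he.comp ((hf.comp fst).pair snd))).congr
    fun a => by rw [Bool.eq_iff_iff]; simp

end DecEq

end PolyF
end Cost

namespace Cost

open Enc

/-! ## Search trees -/

namespace Search

/-- The value of a node of a search tree: the least total cost of an alternative. -/
def combine {τ : Type} (val : ℕ × τ → ℕ) (cap : ℕ) (l : List (ℕ × List (ℕ × τ))) : ℕ :=
  l.foldr (fun x r => min (x.1 + (x.2.map val).sum) r) cap

/-- Function `1`: the value of a node, whose alternatives are computed by `code`. -/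
def solveBody (code : Exp) : Exp := .call 2 (.pair code (.add (.fst (.var 0)) (.lit 1)))

/-- Function `2`: the minimum over a list of alternatives. -/
def minBody : Exp := .ifz (.fst (.var 0)) (.snd (.var 0))
  (.bind (.add (.fst (.fst (.fst (.var 0)))) (.call 3 (.snd (.fst (.fst (.var 0))))))
    (.bind (.call 2 (.pair (.snd (.fst (.var 1))) (.snd (.var 1))))
      (.sub (.var 0) (.sub (.var 0) (.var 1)))))

/-- Function `3`: the sum of the values of the nodes in a list. -/
def sumBody : Exp := .ifz (.var 0) (.lit 0)
  (.add (.call 1 (.fst (.var 0))) (.call 3 (.snd (.var 0))))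

variable {τ : Type} [Enc τ]

/-- The steps inside the nodes are charged to `T`. What remains is a bounded number of operations
per node, on numbers that are at most `B` and hence have at most `B` bits. -/
theorem eval_sumBody {p : Prog} {body : Exp} (h1 : p[1]? = some body) (h3 : p[3]? = some sumBody)
    {val : ℕ × τ → ℕ} {T : ℕ × τ → ℝ} {B : ℕ} (l : List (ℕ × τ))
    (h : ∀ s ∈ l, ∃ t : ℕ, Eval p [enc s] body (.num (val s)) t ∧ (t : ℝ) ≤ T s)
    (hB : (l.map val).sum ≤ B) :
    ∃ t : ℕ, Eval p [enc l] sumBody (.num (l.map val).sum) t ∧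
      (t : ℝ) ≤ (l.map T).sum + (l.length + 1) * (10 + 2 * B) := by
  induction l with
  | nil =>
    refine ⟨_, .ifz_zero (.var (by simp)) .lit, ?_⟩
    simp; nlinarith [(Nat.cast_nonneg B : (0 : ℝ) ≤ B)]
  | cons s l ih =>
    simp only [List.map_cons, List.sum_cons] at hB ⊢
    obtain ⟨t, ht, hT⟩ := ih (fun s hs => h s (by simp [hs])) (by omega)
    obtain ⟨t', ht', hT'⟩ := h s (by simp)
    refine ⟨_, .ifz_nonzero (x := .pair (enc s) (enc l)) (.var (by simp)) (by simp)
      (.add (.call (.fst (y := enc l) (.var (by simp))) h1 ht')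
        (.call (.snd (x := enc s) (.var (by simp))) h3 ht)), ?_⟩
    have e1 : (Nat.size (val s) : ℝ) ≤ B := by
      exact_mod_cast (size_le_self _).trans (by omega)
    have e2 : (Nat.size (l.map val).sum : ℝ) ≤ B := by
      exact_mod_cast (size_le_self _).trans (by omega)
    push_cast
    simp only [List.length_cons]
    push_cast
    nlinarith

/-- As for the sums, the overhead beyond the nodes' own costs is polynomial in the number of
alternatives, their lengths and the bound `B` on values. The cap bounds every intermediate minimum.
-/
theorem eval_minBody {p : Prog} {body : Exp} (h1 : p[1]? = some body) (h2 : p[2]? = some minBody)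
    (h3 : p[3]? = some sumBody) {val : ℕ × τ → ℕ} {T : ℕ × τ → ℝ} {B L cap : ℕ}
    (l : List (ℕ × List (ℕ × τ)))
    (h : ∀ x ∈ l, ∀ s ∈ x.2, ∃ t : ℕ, Eval p [enc s] body (.num (val s)) t ∧ (t : ℝ) ≤ T s)
    (hB : ∀ x ∈ l, (x.2.map val).sum ≤ B) (hL : ∀ x ∈ l, x.2.length ≤ L)
    (hx : ∀ x ∈ l, Nat.size x.1 ≤ B) (hcap : cap ≤ B) :
    ∃ t : ℕ, Eval p [.pair (enc l) (.num cap)] minBody (.num (combine val cap l)) t ∧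
      (t : ℝ) ≤ (l.map fun x => (x.2.map T).sum).sum +
        (l.length + 1) * (50 + 20 * B + (L + 1) * (10 + 2 * B)) := by
  have hc : ∀ l, combine val cap l ≤ B := by
    intro l; induction l with
    | nil => exact hcap
    | cons x l ih => exact (min_le_right _ _).trans ih
  have hB0 : (0 : ℝ) ≤ B := Nat.cast_nonneg B
  have hL0 : (0 : ℝ) ≤ L := Nat.cast_nonneg L
  induction l with
  | nil =>
    rw [show combine val cap ([] : List (ℕ × List (ℕ × τ))) = cap from rfl]
    refine ⟨_, .ifz_zero (.fst (y := .num cap) (.var (by simp)))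
      (.snd (x := .num 0) (.var (by simp))), ?_⟩
    simp; nlinarith [mul_nonneg hL0 hB0]
  | cons x l ih =>
    obtain ⟨t, ht, hT⟩ := ih (fun y hy => h y (by simp [hy])) (fun y hy => hB y (by simp [hy]))
      (fun y hy => hL y (by simp [hy])) (fun y hy => hx y (by simp [hy]))
    obtain ⟨t', ht', hT'⟩ := eval_sumBody h1 h3 x.2 (h x (by simp)) (hB x (by simp))
    -- With truncated subtraction, r - (r - s) is the minimum of r and s; this is how `minBody`
    -- computes it.
    have hm : combine val cap (x :: l) = combine val cap l -
        (combine val cap l - (x.1 + (x.2.map val).sum)) := by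
      change min (x.1 + (x.2.map val).sum) (combine val cap l) = _
      omega
    rw [hm]
    have hv : ∀ e : List Val, (Val.pair (enc (x :: l)) (.num cap) :: e)[0]? =
        some (.pair (.pair (.pair (.num x.1) (enc x.2)) (enc l)) (.num cap)) := fun e => by simp
    have hv' : ∀ (v : Val) (e : List Val), (v :: Val.pair (enc (x :: l)) (.num cap) :: e)[1]? =
        some (.pair (.pair (.pair (.num x.1) (enc x.2)) (enc l)) (.num cap)) := fun v e => by simp
    refine ⟨_, .ifz_nonzero (.fst (.var (hv _))) (by simp)
      (.bind (.add (.fst (.fst (.fst (.var (hv _)))))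
        (.call (.snd (.fst (.fst (.var (hv _))))) h3 ht'))
        (.bind (.call (.pair (.snd (.fst (.var (hv' _ _))))
          (.snd (.var (hv' _ _)))) h2 ht)
          (.sub (.var (by simp)) (.sub (.var (by simp)) (.var (by simp)))))), ?_⟩
    have e1 : (Nat.size x.1 : ℝ) ≤ B := by exact_mod_cast hx x (by simp)
    have e2 : (Nat.size (x.2.map val).sum : ℝ) ≤ B := by
      exact_mod_cast (size_le_self _).trans (hB x (by simp))
    have e3 : (Nat.size (combine val cap l) : ℝ) ≤ B := by
      exact_mod_cast (size_le_self _).trans (hc l)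
    have e4 : (Nat.size (combine val cap l - (x.1 + (x.2.map val).sum)) : ℝ) ≤ B := by
      exact_mod_cast (size_le_self _).trans ((Nat.sub_le _ _).trans (hc l))
    have e5 : (Nat.size (x.1 + (x.2.map val).sum) : ℝ) ≤ 1 + 2 * B := by
      have := size_add_le x.1 (x.2.map val).sum
      have : (Nat.size (x.1 + (x.2.map val).sum) : ℝ) ≤
        1 + Nat.size x.1 + Nat.size (x.2.map val).sum := by exact_mod_cast this
      linarith
    have e6 : (x.2.length : ℝ) ≤ L := by exact_mod_cast hL x (by simp)
    have e7 : ((x.2.length : ℝ) + 1) * (10 + 2 * B) ≤ (L + 1) * (10 + 2 * B) := by gcongr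
    simp only [List.map_cons, List.sum_cons, List.length_cons]
    push_cast
    nlinarith

/-- A search tree whose nodes are expanded in polynomial time can be evaluated in time proportional
to a bound `W` on its number of nodes. -/
theorem eval_solve {expand : ℕ × τ → List (ℕ × List (ℕ × τ))} (he : PolyF expand) :
    ∃ Q : Polynomial ℕ, ∀ n, ∃ ext code, ∀ p : Prog, Has p n ext →
      p[1]? = some (solveBody code) → p[2]? = some minBody → p[3]? = some sumBody →
      ∀ (Good : ℕ × τ → Prop) (val : ℕ × τ → ℕ) (W : ℕ × τ → ℝ) (M : ℕ),
        (∀ s, Good s → sz s ≤ M ∧ s.1 ≤ M) →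
        (∀ s, Good s → ∀ x ∈ expand s, ∀ s' ∈ x.2, Good s') →
        (∀ s, Good s → val s = combine val (s.1 + 1) (expand s)) →
        (∀ s, 0 ≤ W s) →
        (∀ s, Good s → ((expand s).map fun x => (x.2.map W).sum).sum + 1 ≤ W s) →
        ∀ s, Good s → ∃ t : ℕ, Eval p [enc s] (solveBody code) (.num (val s)) t ∧
          (t : ℝ) ≤ W s * Q.eval M := by
  obtain ⟨q, hq⟩ := he
  -- a bound on all numbers that occur
  let b : Polynomial ℕ := q * (.X + 1) + q + .X + 1
  let Q : Polynomial ℕ := q + 20 + 2 * b + (q + 1) * (50 + 20 * b + (q + 1) * (10 + 2 * b))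
  refine ⟨Q, fun n => ?_⟩
  obtain ⟨ext, code, hcode⟩ := hq n
  refine ⟨ext, code, fun p hp h1 h2 h3 Good val W M hM hG hval hW0 hW => ?_⟩
  -- Induction on an integer bound for `W s`: the inequality for `W` makes it drop by at least 1
  -- from a node to each child.
  have main : ∀ (m : ℕ) (s : ℕ × τ), Good s → W s ≤ m →
      ∃ t : ℕ, Eval p [enc s] (solveBody code) (.num (val s)) t ∧ (t : ℝ) ≤ W s * Q.eval M := by
    intro m
    induction m with
    | zero =>
      intro s hs hm
      have h := hW s hs
      have : 0 ≤ ((expand s).map fun x => (x.2.map W).sum).sum := by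
        refine List.sum_nonneg fun y hy => ?_
        obtain ⟨x, -, rfl⟩ := List.mem_map.1 hy
        refine List.sum_nonneg fun z hz => ?_
        obtain ⟨s', -, rfl⟩ := List.mem_map.1 hz
        exact hW0 s'
      push_cast at hm
      linarith
    | succ m ih =>
      intro s hs hm
      obtain ⟨hsM, hkM⟩ := hM s hs
      obtain ⟨t, ht, htq, hsz⟩ := hcode p hp s []
      have hqM : q.eval (sz s) ≤ q.eval M := eval_mono q hsM
      have hszx : ∀ x ∈ expand s, sz x < q.eval M := fun x hx =>
        (sz_mem hx).trans_le (hsz.trans hqM)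
      -- The cap keeps the values small, which bounds the cost of all arithmetic.
      have hval' : ∀ s, Good s → val s ≤ M + 1 := by
        intro s hs
        rw [hval s hs]
        have hc : ∀ l, combine val (s.1 + 1) l ≤ s.1 + 1 := by
          intro l; induction l with
          | nil => exact le_rfl
          | cons x l ih => exact (min_le_right _ _).trans ih
        exact (hc _).trans (by have := (hM s hs).2; omega)
      have hL : ∀ x ∈ expand s, x.2.length ≤ q.eval M := by
        intro x hx
        have h4 := hszx x hx
        have h5 := length_lt_sz x.2
        simp only [sz_prod] at h4
        omega
      have hbM : b.eval M = q.eval M * (M + 1) + q.eval M + M + 1 := by simp [b]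
      have hlow : ∀ x ∈ expand s, ∀ s' ∈ x.2, W s' ≤ m := by
        intro x hx s' hs'
        have h4 := hW s hs
        have h5 : W s' ≤ ((expand s).map fun x => (x.2.map W).sum).sum := by
          have h6 : W s' ≤ (x.2.map W).sum :=
            List.single_le_sum (fun y hy => by
              obtain ⟨s', -, rfl⟩ := List.mem_map.1 hy
              exact hW0 s') _
              (List.mem_map_of_mem hs')
          refine h6.trans (List.single_le_sum (l := (expand s).map fun x => (x.2.map W).sum) ?_ _
            (List.mem_map.2 ⟨x, hx, rfl⟩))
          intro y hy
          obtain ⟨x, -, rfl⟩ := List.mem_map.1 hy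
          refine List.sum_nonneg fun z hz => ?_
          obtain ⟨s', -, rfl⟩ := List.mem_map.1 hz
          exact hW0 s'
        push_cast at hm
        linarith
      have hsum : ∀ x ∈ expand s, (x.2.map val).sum ≤ b.eval M := by
        intro x hx
        have h4 : (x.2.map val).sum ≤ x.2.length * (M + 1) := by
          have := List.sum_le_card_nsmul (x.2.map val) (M + 1) ?_
          · simpa using this
          · intro y hy
            obtain ⟨s', hs', rfl⟩ := List.mem_map.1 hy
            exact hval' s' (hG s hs x hx s' hs')
        have h5 := Nat.mul_le_mul_right (M + 1) (hL x hx)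
        rw [hbM]; omega
      have hnum : ∀ x ∈ expand s, Nat.size x.1 ≤ b.eval M := by
        intro x hx
        have h4 := hszx x hx
        simp only [sz_prod, sz_nat] at h4
        rw [hbM]; omega
      obtain ⟨t', ht', hT'⟩ := eval_minBody (T := fun s => W s * Q.eval M) (B := b.eval M)
        (L := q.eval M) (cap := s.1 + 1) h1 h2 h3 (expand s)
        (fun x hx s' hs' => ih s' (hG s hs x hx s' hs') (hlow x hx s' hs')) hsum hL hnum
        (by rw [hbM]; omega)
      rw [hval s hs]
      refine ⟨_, .call (.pair ht (.add (.fst (y := enc s.2) (.var (by simp))) .lit)) h2 ht', ?_⟩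
      have e1 : (t : ℝ) ≤ q.eval M := by exact_mod_cast htq.trans hqM
      have e2 : (Nat.size s.1 : ℝ) ≤ b.eval M := by
        exact_mod_cast (size_le_self _).trans (by rw [hbM]; omega)
      have e3 : ((expand s).length : ℝ) ≤ q.eval M := by
        exact_mod_cast (length_lt_sz _).le.trans (hsz.trans hqM)
      have e4 : ((expand s).map fun x => (x.2.map fun s => W s * (Q.eval M : ℕ)).sum).sum =
          ((expand s).map fun x => (x.2.map W).sum).sum * (Q.eval M : ℕ) := by
        simp only [List.sum_map_mul_right]
      have e5 : ((Q.eval M : ℕ) : ℝ) = q.eval M + 20 + 2 * (b.eval M : ℕ) + (q.eval M + 1) *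
          (50 + 20 * (b.eval M : ℕ) + (q.eval M + 1) * (10 + 2 * (b.eval M : ℕ))) := by
        simp [Q]
      -- The summand 1 in the inequality for `W`, multiplied by `Q.eval M`, pays for the work at the
      -- node itself.
      have e6 := mul_le_mul_of_nonneg_right (hW s hs) (Nat.cast_nonneg (α := ℝ) (Q.eval M))
      have e7 : (((expand s).length : ℝ) + 1) * (50 + 20 * (b.eval M : ℕ) +
          (((q.eval M : ℕ) : ℝ) + 1) * (10 + 2 * (b.eval M : ℕ))) ≤ (((q.eval M : ℕ) : ℝ) + 1) *
          (50 + 20 * (b.eval M : ℕ) + (((q.eval M : ℕ) : ℝ) + 1) *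
            (10 + 2 * (b.eval M : ℕ))) := by gcongr
      rw [e4] at hT'
      have e8 : Nat.size 1 = 1 := Nat.size_one
      push_cast
      rw [e8, Nat.cast_one]
      linarith
  intro s hs
  obtain ⟨m, hm⟩ := exists_nat_ge (W s)
  exact main m s hs hm

end Search
end Cost

namespace VC

open Cost

variable {ν : Type} [DecidableEq ν]

/-! ## Vertex covers of graphs given by edge lists -/

/-- Remove duplicates. -/
def uniq (l : List ν) : List ν := l.foldr (fun x r => bif decide (x ∈ r) then r else x :: r) []

@[simp] theorem mem_uniq {l : List ν} {x : ν} : x ∈ uniq l ↔ x ∈ l := by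
  induction l with
  | nil => simp [uniq]
  | cons y l ih =>
    have : uniq (y :: l) = bif decide (y ∈ uniq l) then uniq l else y :: uniq l := rfl
    rw [this]
    by_cases h : y ∈ uniq l
    · simp only [h, decide_true, cond_true, ih, List.mem_cons]
      constructor
      · exact Or.inr
      · rintro (rfl | h')
        · exact ih.1 h
        · exact h'
    · simp [h, ih]

theorem nodup_uniq (l : List ν) : (uniq l).Nodup := by
  induction l with
  | nil => simp [uniq]
  | cons y l ih =>
    have : uniq (y :: l) = bif decide (y ∈ uniq l) then uniq l else y :: uniq l := rfl
    rw [this]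
    by_cases h : y ∈ uniq l
    · simpa [h] using ih
    · simp only [h, decide_false, cond_false, List.nodup_cons, not_false_eq_true, true_and]
      exact ih

theorem uniq_sublist (l : List ν) : (uniq l).Sublist l := by
  induction l with
  | nil => simp [uniq]
  | cons y l ih =>
    have : uniq (y :: l) = bif decide (y ∈ uniq l) then uniq l else y :: uniq l := rfl
    rw [this]
    by_cases h : y ∈ uniq l
    · simpa [h] using ih.trans (List.sublist_cons_self _ _)
    · simp only [h, decide_false, cond_false]
      exact ih.cons_cons y

/-- The union of two lists without duplicates. -/
def join (l l' : List ν) : List ν := (l.filter fun x => !decide (x ∈ l')) ++ l'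

@[simp] theorem mem_join {l l' : List ν} {x : ν} : x ∈ join l l' ↔ x ∈ l ∨ x ∈ l' := by
  by_cases h : x ∈ l' <;> simp [join, h]

theorem nodup_join {l l' : List ν} (h : l.Nodup) (h' : l'.Nodup) : (join l l').Nodup := by
  refine List.Nodup.append (h.filter _) h' ?_
  intro x hx hx'
  simp [hx'] at hx

/-- The intersection of two lists. -/
def inter (l l' : List ν) : List ν := l.filter fun x => decide (x ∈ l')

@[simp] theorem mem_inter {l l' : List ν} {x : ν} : x ∈ inter l l' ↔ x ∈ l ∧ x ∈ l' := by
  simp [inter]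

theorem nodup_inter {l l' : List ν} (h : l.Nodup) : (inter l l').Nodup := h.filter _

/-- The vertices that lie on an edge. -/
def verts (E : List (ν × ν)) : List ν := uniq (E.map Prod.fst)

/-- The neighbours of a vertex. -/
def nbr (E : List (ν × ν)) (x : ν) : List ν :=
  uniq ((E.filter fun e => decide (e.1 = x)).map Prod.snd)

/-- Delete the vertices in `Q`. -/
def del (E : List (ν × ν)) (Q : List ν) : List (ν × ν) :=
  E.filter fun e => !(decide (e.1 ∈ Q) || decide (e.2 ∈ Q))

/-- The list contains every edge in both directions, and there are no loops. -/
def Sym (E : List (ν × ν)) : Prop := ∀ u v, (u, v) ∈ E → (v, u) ∈ E ∧ u ≠ v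

/-- `C` is a vertex cover of `E`. -/
def IsCover (E : List (ν × ν)) (C : Finset ν) : Prop := ∀ e ∈ E, e.1 ∈ C ∨ e.2 ∈ C

/-- The vertex cover number. -/
noncomputable def tau (E : List (ν × ν)) : ℕ := sInf {k | ∃ C, IsCover E C ∧ C.card = k}

variable {E : List (ν × ν)} {x y : ν} {Q : List ν} {C : Finset ν}

@[simp] theorem mem_nbr : y ∈ nbr E x ↔ (x, y) ∈ E := by
  simp only [nbr, mem_uniq, List.mem_map, List.mem_filter, decide_eq_true_eq]
  constructor
  · rintro ⟨⟨a, b⟩, ⟨h, rfl⟩, rfl⟩; exact h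
  · intro h; exact ⟨(x, y), ⟨h, rfl⟩, rfl⟩

theorem nodup_nbr : (nbr E x).Nodup := nodup_uniq _

theorem mem_verts : x ∈ verts E ↔ ∃ y, (x, y) ∈ E := by simp [verts]

theorem mem_verts_iff_length : x ∈ verts E ↔ 0 < (nbr E x).length := by
  rw [mem_verts, List.length_pos_iff_exists_mem]; simp

theorem mem_del {e : ν × ν} : e ∈ del E Q ↔ e ∈ E ∧ e.1 ∉ Q ∧ e.2 ∉ Q := by simp [del]

theorem del_sublist : (del E Q).Sublist E := List.filter_sublist

theorem Sym.filter (hE : Sym E) {p : ν × ν → Bool}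
    (hp : ∀ u v, (u, v) ∈ E → p (u, v) → p (v, u)) : Sym (E.filter p) := by
  intro u v h
  obtain ⟨h, h'⟩ := List.mem_filter.1 h
  exact ⟨List.mem_filter.2 ⟨(hE u v h).1, hp u v h h'⟩, (hE u v h).2⟩

theorem Sym.del (hE : Sym E) : Sym (del E Q) :=
  hE.filter fun u v _ h => by simp at h ⊢; tauto

theorem exists_isCover_card_eq_tau (E : List (ν × ν)) : ∃ C, IsCover E C ∧ C.card = tau E :=
  Nat.sInf_mem (s := {k | ∃ C, IsCover E C ∧ C.card = k})
    ⟨_, (E.map Prod.fst).toFinset, fun e he => Or.inl (by simpa using ⟨e.2, he⟩), rfl⟩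

theorem tau_le_card (h : IsCover E C) : tau E ≤ C.card := Nat.sInf_le ⟨C, h, rfl⟩

theorem tau_le_length_add (E : List (ν × ν)) (Q : List ν) : tau E ≤ Q.length + tau (del E Q) := by
  obtain ⟨C, h, hC⟩ := exists_isCover_card_eq_tau (del E Q)
  have : IsCover E (Q.toFinset ∪ C) := by
    intro e he
    by_cases h1 : e.1 ∈ Q
    · simp [h1]
    by_cases h2 : e.2 ∈ Q
    · simp [h2]
    rcases h e (mem_del.2 ⟨he, h1, h2⟩) with h | h <;> simp [h]
  have h1 := tau_le_card this
  have h2 := Finset.card_union_le Q.toFinset C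
  have h3 := Q.toFinset_card_le
  omega

/-- The converse of `tau_le_length_add` for a set that lies in a cover: the rest of the cover covers
what is left. Distinctness of the elements of `Q` makes its length its cardinality. -/
theorem length_add_tau_le (h : IsCover E C) (hQ : Q.Nodup) (hC : Q.toFinset ⊆ C) :
    Q.length + tau (del E Q) ≤ C.card := by
  have : IsCover (del E Q) (C \ Q.toFinset) := by
    intro e he
    obtain ⟨he, h1, h2⟩ := mem_del.1 he
    rcases h e he with h | h
    · exact Or.inl (by simp [h, h1])
    · exact Or.inr (by simp [h, h2])
  have h1 := tau_le_card this
  have h2 := Finset.card_sdiff_add_card_eq_card hC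
  have h3 := List.toFinset_card_of_nodup hQ
  omega

/-! ### Branchings -/

/-- Every vertex cover can be replaced by one that is not larger and contains one of the sets in
the list `B`. -/
def IsBranching (E : List (ν × ν)) (B : List (List ν)) : Prop :=
  (∀ Q ∈ B, Q.Nodup) ∧ ∀ C, IsCover E C →
    ∃ Q ∈ B, ∃ C', IsCover E C' ∧ C'.card ≤ C.card ∧ ∀ q ∈ Q, q ∈ C'

/-- The nodes of the search tree that correspond to the branches. -/
def alts (k : ℕ) (E : List (ν × ν)) (B : List (List ν)) :
    List (ℕ × List (ℕ × List (ν × ν))) :=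
  (B.filter fun Q => decide (Q.length ≤ k)).map fun Q => (Q.length, [(k - Q.length, del E Q)])

/-- The vertex cover number, as far as it does not exceed the budget. -/
noncomputable def val (s : ℕ × List (ν × ν)) : ℕ := min (tau s.2) (s.1 + 1)

theorem le_combine {τ : Type} {val : ℕ × τ → ℕ} {cap m : ℕ} {l : List (ℕ × List (ℕ × τ))} :
    m ≤ Search.combine val cap l ↔ m ≤ cap ∧ ∀ x ∈ l, m ≤ x.1 + (x.2.map val).sum := by
  induction l with
  | nil => simp [Search.combine]
  | cons x l ih =>
    have : Search.combine val cap (x :: l) =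
      min (x.1 + (x.2.map val).sum) (Search.combine val cap l) := rfl
    rw [this, le_min_iff, ih, List.forall_mem_cons]
    tauto

/-- No branch can beat the optimum, since adding `Q` to a cover of the rest gives a cover.
Conversely, an optimal cover within the budget may be assumed to contain some `Q`; this `Q` then
fits the budget and survives the filter. If the optimum exceeds the budget, the cap decides. -/
theorem IsBranching.val_eq {B : List (List ν)} (hB : IsBranching E B) (k : ℕ) :
    val (k, E) = Search.combine val (k + 1) (alts k E B) := by
  apply le_antisymm
  · rw [le_combine]
    refine ⟨min_le_right _ _, fun z hz => ?_⟩
    simp only [alts, List.mem_map, List.mem_filter, decide_eq_true_eq] at hz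
    obtain ⟨Q, ⟨-, hQ⟩, rfl⟩ := hz
    have := tau_le_length_add E Q
    simp only [val, List.map_cons, List.map_nil, List.sum_cons, List.sum_nil]
    omega
  · have h0 := (le_combine (m := Search.combine val (k + 1) (alts k E B))).1 le_rfl
    refine le_min ?_ h0.1
    by_cases hk : k < tau E
    · exact h0.1.trans hk
    obtain ⟨C, hC, hCt⟩ := exists_isCover_card_eq_tau E
    obtain ⟨Q, hQ, C', h1, h2, h3⟩ := hB.2 C hC
    have h4 := length_add_tau_le h1 (hB.1 Q hQ) (fun q hq => h3 q (by simpa using hq))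
    refine (h0.2 (Q.length, [(k - Q.length, del E Q)]) ?_).trans ?_
    · simp only [alts, List.mem_map, List.mem_filter, decide_eq_true_eq]
      exact ⟨Q, ⟨hQ, by omega⟩, rfl⟩
    · simp only [val, List.map_cons, List.map_nil, List.sum_cons, List.sum_nil]
      omega

theorem IsCover.mem_of_nbr (hC : IsCover E C) (hx : x ∉ C) : ∀ y ∈ nbr E x, y ∈ C :=
  fun y hy => (hC (x, y) (mem_nbr.1 hy)).resolve_left hx

/-- Either some vertex cover of the same size contains all neighbours of `x`, or two neighbours of
`x` are left out. -/
theorem IsCover.exists_nbr (hE : Sym E) (hC : IsCover E C) (x : ν) :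
    (∃ C', IsCover E C' ∧ C'.card ≤ C.card ∧ ∀ y ∈ nbr E x, y ∈ C') ∨
      ∃ y ∈ nbr E x, ∃ z ∈ nbr E x, y ≠ z ∧ y ∉ C ∧ z ∉ C := by
  by_cases hx : x ∈ C
  · by_cases h : ((nbr E x).toFinset \ C).card ≤ 1
    · left
      -- At most one neighbour of `x` is missing, so `x` can be exchanged for it without enlarging
      -- the cover.
      refine ⟨C.erase x ∪ ((nbr E x).toFinset \ C), ?_, ?_, ?_⟩
      · rintro ⟨u, v⟩ he
        have he' := (hE u v he).1
        by_cases hu : u = x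
        · subst hu
          right
          have := (hE _ _ he).2.symm
          by_cases hv : v ∈ C <;> simp [hv, he, this]
        by_cases hv : v = x
        · subst hv
          left
          have := (hE _ _ he).2
          by_cases hv : u ∈ C <;> simp [hv, he', this]
        rcases hC _ he with h | h
        · left; simp_all
        · right; simp_all
      · have h1 := Finset.card_union_le (C.erase x) ((nbr E x).toFinset \ C)
        have h2 := Finset.card_erase_add_one hx
        omega
      · intro y hy
        have : y ≠ x := (hE _ _ (mem_nbr.1 hy)).2.symm
        by_cases hv : y ∈ C
        · simp [hv, this]
        · simp only [Finset.mem_union, Finset.mem_sdiff, List.mem_toFinset]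
          exact Or.inr ⟨hy, hv⟩
    · right
      obtain ⟨y, hy, z, hz, h⟩ := Finset.one_lt_card.1 (not_le.1 h)
      simp only [Finset.mem_sdiff, List.mem_toFinset] at hy hz
      exact ⟨y, hy.1, z, hz.1, h, hy.2, hz.2⟩
  · exact Or.inl ⟨C, hC, le_rfl, hC.mem_of_nbr hx⟩

/-- Branch on the neighbourhood of `x`: otherwise two neighbours of `x` are left out. -/
theorem isBranching_nbr_cons (hE : Sym E) (x : ν) {B : List (List ν)} (hn : ∀ Q ∈ B, Q.Nodup)
    (hB : ∀ C, IsCover E C → ∀ y ∈ nbr E x, ∀ z ∈ nbr E x, y ≠ z → y ∉ C → z ∉ C →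
      ∃ Q ∈ B, ∃ C', IsCover E C' ∧ C'.card ≤ C.card ∧ ∀ q ∈ Q, q ∈ C') :
    IsBranching E (nbr E x :: B) := by
  refine ⟨by simpa using ⟨nodup_nbr, hn⟩, fun C hC => ?_⟩
  rcases hC.exists_nbr hE x with ⟨C', h⟩ | ⟨y, hy, z, hz, h, h1, h2⟩
  · exact ⟨_, List.mem_cons_self, C', h⟩
  · obtain ⟨Q, hQ, h⟩ := hB C hC y hy z hz h h1 h2
    exact ⟨Q, List.mem_cons_of_mem _ hQ, h⟩

/-- A cover that omits `x` contains all its neighbours. -/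
theorem isBranching_vertex (E : List (ν × ν)) (x : ν) : IsBranching E [[x], nbr E x] := by
  refine ⟨by simpa using nodup_nbr, fun C hC => ?_⟩
  by_cases hx : x ∈ C
  · exact ⟨[x], by simp, C, hC, le_rfl, by simpa using hx⟩
  · exact ⟨nbr E x, by simp, C, hC, le_rfl, hC.mem_of_nbr hx⟩

end VC

namespace VC

open Cost

variable {ν : Type} [DecidableEq ν]

/-! ### The branching rules -/

/-- Branchings at a vertex with the two neighbours `N`. -/
def rulesTwo (E : List (ν × ν)) (N : List ν) : List (List (List ν)) :=
  N.flatMap fun a => N.flatMap fun b =>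
    bif decide (a = b) then [] else
    bif decide (b ∈ nbr E a) then [[N]] else
    bif decide ((join (nbr E a) (nbr E b)).length ≤ 2) then [[join (nbr E a) (nbr E b)]] else
    [[N, join (nbr E a) (nbr E b)]]

/-- Branchings at a vertex with the three neighbours `N`, which are `a`, `b` and `c`. -/
def rulesThreeAt (E : List (ν × ν)) (N : List ν) (a b c : ν) : List (List (List ν)) :=
  bif decide (b ∈ nbr E a) then
    (bif decide (3 ≤ (nbr E c).length) then [[N, nbr E c]] else []) else
  bif decide (2 ≤ (inter (nbr E a) (nbr E b)).length) then
    [[N, inter (nbr E a) (nbr E b)]] else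
  bif decide (4 ≤ (nbr E a).length) &&
      decide (6 ≤ (join [a] (join (nbr E b) (nbr E c))).length) then
    [[N, nbr E a, join [a] (join (nbr E b) (nbr E c))]] else []

/-- Branchings at a vertex with the three neighbours `N`. -/
def rulesThree (E : List (ν × ν)) (N : List ν) : List (List (List ν)) :=
  N.flatMap fun a => N.flatMap fun b => N.flatMap fun c =>
    bif decide (a = b) || (decide (a = c) || decide (b = c)) then [] else rulesThreeAt E N a b c

/-- Branchings at the vertex `x`. -/
def rulesAt (E : List (ν × ν)) (x : ν) : List (List (List ν)) :=
  bif decide (5 ≤ (nbr E x).length) then [[[x], nbr E x]] else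
  bif decide ((nbr E x).length = 1) then [[nbr E x]] else
  bif decide ((nbr E x).length = 2) then rulesTwo E (nbr E x) else
  bif decide ((nbr E x).length = 3) then rulesThree E (nbr E x) else []

/-- All branchings that the rules provide. -/
def rules (E : List (ν × ν)) : List (List (List ν)) := (verts E).flatMap (rulesAt E)

variable {E : List (ν × ν)} {x y a b c : ν} {B : List (List ν)}

/-- The base of the exponential running time. -/
noncomputable def base : ℝ := 1.3249

/-- The branches have small total weight. -/
def Light (B : List (List ν)) : Prop :=
  (B.map fun Q => base⁻¹ ^ Q.length).sum ≤ 1 - 1 / 5000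

theorem light_one {P : List ν} (h : 1 ≤ P.length) : Light [P] := by
  have h1 : base⁻¹ ^ P.length ≤ base⁻¹ ^ 1 :=
    pow_le_pow_of_le_one (by norm_num [base]) (by norm_num [base]) h
  simp only [Light, List.map_cons, List.map_nil, List.sum_cons, List.sum_nil]
  norm_num [base] at h1 ⊢
  linarith

/-- Used with the vectors (1,5), (2,3), (3,2) and (3,3). The first three have the root 1.3247… and
determine the base and the slack. -/
theorem light_two {P Q : List ν} {i j : ℕ} (h : i ≤ P.length) (h' : j ≤ Q.length)
    (hij : base⁻¹ ^ i + base⁻¹ ^ j ≤ 1 - 1 / 5000) : Light [P, Q] := by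
  have h1 : base⁻¹ ^ P.length ≤ base⁻¹ ^ i :=
    pow_le_pow_of_le_one (by norm_num [base]) (by norm_num [base]) h
  have h2 : base⁻¹ ^ Q.length ≤ base⁻¹ ^ j :=
    pow_le_pow_of_le_one (by norm_num [base]) (by norm_num [base]) h'
  simp only [Light, List.map_cons, List.map_nil, List.sum_cons, List.sum_nil]
  linarith

theorem light_three {P Q R : List ν} (h : 3 ≤ P.length) (h' : 4 ≤ Q.length) (h'' : 6 ≤ R.length) :
    Light [P, Q, R] := by
  have h1 : base⁻¹ ^ P.length ≤ base⁻¹ ^ 3 :=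
    pow_le_pow_of_le_one (by norm_num [base]) (by norm_num [base]) h
  have h2 : base⁻¹ ^ Q.length ≤ base⁻¹ ^ 4 :=
    pow_le_pow_of_le_one (by norm_num [base]) (by norm_num [base]) h'
  have h3 : base⁻¹ ^ R.length ≤ base⁻¹ ^ 6 :=
    pow_le_pow_of_le_one (by norm_num [base]) (by norm_num [base]) h''
  have h4 : base⁻¹ ^ 3 + base⁻¹ ^ 4 + base⁻¹ ^ 6 ≤ 1 - 1 / 5000 := by norm_num [base]
  simp only [Light, List.map_cons, List.map_nil, List.sum_cons, List.sum_nil]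
  linarith

theorem mem_pair_of_length {N : List ν} (h : N.length = 2) (ha : a ∈ N) (hb : b ∈ N)
    (hab : a ≠ b) {y : ν} (hy : y ∈ N) : y = a ∨ y = b := by
  match N, h with
  | [u, v], _ => simp at ha hb hy; aesop

theorem mem_triple_of_length {N : List ν} (h : N.length = 3) (ha : a ∈ N) (hb : b ∈ N)
    (hc : c ∈ N) (hab : a ≠ b) (hac : a ≠ c) (hbc : b ≠ c) {y : ν} (hy : y ∈ N) :
    y = a ∨ y = b ∨ y = c := by
  match N, h with
  | [u, v, w], _ =>
    simp only [List.mem_cons, List.not_mem_nil, or_false] at ha hb hc hy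
    grind

/-- If `N(x)` cannot be taken, both neighbours `a` and `b` stay outside the cover. This is
impossible when they are adjacent, and otherwise forces N(a) ∪ N(b) into the cover. If this union
has at most two elements, it can be taken without branching. -/
theorem isBranching_of_mem_rulesTwo (hE : Sym E) (hx : (nbr E x).length = 2)
    (hB : B ∈ rulesTwo E (nbr E x)) : IsBranching E B ∧ Light B := by
  simp only [rulesTwo, List.mem_flatMap] at hB
  obtain ⟨a, ha, b, hb, hB⟩ := hB
  by_cases hab : a = b
  · simp [hab] at hB
  have two := fun y hy => mem_pair_of_length hx ha hb hab (y := y) hy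
  -- the two neighbours that are left out must be `a` and `b`
  have out : ∀ C : Finset ν, ∀ y ∈ nbr E x, ∀ z ∈ nbr E x, y ≠ z → y ∉ C → z ∉ C →
      a ∉ C ∧ b ∉ C := by
    intro C y hy z hz h h1 h2
    have := two y hy
    have := two z hz
    grind
  simp only [hab, decide_false, cond_false] at hB
  by_cases hadj : b ∈ nbr E a
  · simp only [hadj, decide_true, cond_true, List.mem_singleton] at hB
    subst hB
    refine ⟨isBranching_nbr_cons hE x (by simp) ?_, light_one (by omega)⟩
    intro C hC y hy z hz h h1 h2
    obtain ⟨h3, h4⟩ := out C y hy z hz h h1 h2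
    exact absurd (hC.mem_of_nbr h3 b hadj) h4
  simp only [hadj, decide_false, cond_false] at hB
  have hn : (join (nbr E a) (nbr E b)).Nodup := nodup_join nodup_nbr nodup_nbr
  have hxU : x ∈ join (nbr E a) (nbr E b) := by
    simp [(hE _ _ (mem_nbr.1 ha)).1]
  by_cases hU : (join (nbr E a) (nbr E b)).length ≤ 2
  · simp only [hU, decide_true, cond_true, List.mem_singleton] at hB
    subst hB
    refine ⟨⟨by simpa using hn, fun C hC => ?_⟩, light_one (List.length_pos_of_mem hxU)⟩
    set U := (join (nbr E a) (nbr E b)).toFinset with hUdef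
    have hmU : ∀ y, y ∈ U ↔ (a, y) ∈ E ∨ (b, y) ∈ E := by simp [hUdef]
    have hUc : U.card ≤ 2 := (List.toFinset_card_le _).trans hU
    -- Exchange `a` and `b` for the union `U` of their neighbourhoods, which covers every edge at
    -- `a` or `b`.
    refine ⟨_, List.mem_singleton_self _, (C \ {a, b}) ∪ U, ?_, ?_, ?_⟩
    · rintro ⟨u, v⟩ he
      have he' := (hE u v he).1
      by_cases hu : u = a ∨ u = b
      · right
        have : v ∈ U := by rw [hmU]; rcases hu with rfl | rfl <;> simp [he]
        simp [this]
      by_cases hv : v = a ∨ v = b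
      · left
        have : u ∈ U := by rw [hmU]; rcases hv with rfl | rfl <;> simp [he']
        simp [this]
      rcases hC _ he with h | h
      · left; simp_all
      · right; simp_all
    · have h1 : (C \ {a, b} ∪ U).card ≤ (C \ {a, b}).card + (U \ C).card := by
        have hs : C \ {a, b} ∪ U ⊆ (C \ {a, b}) ∪ (U \ C) := by
          intro y hy
          have hab' : ∀ y ∈ U, y ≠ a ∧ y ≠ b := by
            intro y hy
            rw [hmU] at hy
            constructor
            · rintro rfl
              rcases hy with h | h
              · exact (hE _ _ h).2 rfl
              · exact hadj (mem_nbr.2 (hE _ _ h).1)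
            · rintro rfl
              rcases hy with h | h
              · exact hadj (mem_nbr.2 h)
              · exact (hE _ _ h).2 rfl
          simp only [Finset.mem_union, Finset.mem_sdiff, Finset.mem_insert,
            Finset.mem_singleton] at hy ⊢
          by_cases hyC : y ∈ C
          · rcases hy with h | h
            · exact Or.inl h
            · have := hab' y h; tauto
          · tauto
        exact (Finset.card_le_card hs).trans (Finset.card_union_le _ _)
      have h2 : (C \ {a, b}).card + (C ∩ {a, b}).card = C.card := Finset.card_sdiff_add_card_inter _ _
      -- The exchange costs nothing. If `x ∈ C`, at most one element of `U` is missing, and a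
      -- missing one has its neighbour among `a`, `b` in `C`. If `x ∉ C`, both `a` and `b` lie in
      -- `C`, and `U` has at most two elements.
      have h3 : (U \ C).card ≤ (C ∩ {a, b}).card := by
        by_cases hxC : x ∈ C
        · have h4 : (U \ C).card + 1 ≤ U.card := by
            have : x ∈ U := by simpa [hUdef] using hxU
            have h5 := Finset.card_lt_card (s := U \ C) (t := U)
              (Finset.ssubset_iff_subset_ne.2 ⟨Finset.sdiff_subset, fun h => by
                rw [← h] at this; simp [hxC] at this⟩)
            omega
          by_cases h6 : (U \ C).card = 0
          · omega
          obtain ⟨y, hy⟩ := Finset.card_pos.1 (Nat.pos_of_ne_zero h6)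
          obtain ⟨hyU, hyC⟩ := Finset.mem_sdiff.1 hy
          have h7 : 0 < (C ∩ {a, b}).card := by
            rw [Finset.card_pos]
            rw [hmU] at hyU
            rcases hyU with h | h
            · exact ⟨a, by simpa using (hC _ h).resolve_right hyC⟩
            · exact ⟨b, by simpa using (hC _ h).resolve_right hyC⟩
          omega
        · have h4 : C ∩ {a, b} = {a, b} := by
            apply Finset.inter_eq_right.2
            intro y hy
            simp only [Finset.mem_insert, Finset.mem_singleton] at hy
            rcases hy with rfl | rfl
            · exact hC.mem_of_nbr hxC _ ha
            · exact hC.mem_of_nbr hxC _ hb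
          rw [h4, Finset.card_pair hab]
          exact (Finset.card_le_card Finset.sdiff_subset).trans hUc
      omega
    · intro q hq
      have : q ∈ U := by simpa [hUdef] using hq
      simp [this]
  · simp only [hU, decide_false, cond_false, List.mem_singleton] at hB
    subst hB
    refine ⟨isBranching_nbr_cons hE x (by simpa using hn) ?_,
      light_two (i := 2) (j := 3) hx.ge (by omega) (by norm_num [base])⟩
    intro C hC y hy z hz h h1 h2
    obtain ⟨h3, h4⟩ := out C y hy z hz h h1 h2
    refine ⟨_, List.mem_singleton_self _, C, hC, le_rfl, fun q hq => ?_⟩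
    rcases mem_join.1 hq with h | h
    · exact hC.mem_of_nbr h3 q h
    · exact hC.mem_of_nbr h4 q h

/-- If `N(x)` cannot be taken, two of `a`, `b`, `c` stay outside. When `a` and `b` are adjacent, `c`
is one of them and `N(c)` is forced. In any case `a` or `b` is outside, so their common neighbours
are forced. The last rule distinguishes whether `a` is outside, and otherwise `b` and `c` both are.
-/
theorem isBranching_of_mem_rulesThree (hE : Sym E) (hx : (nbr E x).length = 3)
    (hB : B ∈ rulesThree E (nbr E x)) : IsBranching E B ∧ Light B := by
  simp only [rulesThree, List.mem_flatMap] at hB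
  obtain ⟨a, ha, b, hb, c, hc, hB⟩ := hB
  by_cases hne : a = b ∨ a = c ∨ b = c
  · have : (decide (a = b) || (decide (a = c) || decide (b = c))) = true := by simpa using hne
    simp [this] at hB
  have : (decide (a = b) || (decide (a = c) || decide (b = c))) = false := by simpa using hne
  rw [this, cond_false] at hB
  obtain ⟨hab, hac, hbc⟩ : a ≠ b ∧ a ≠ c ∧ b ≠ c := by tauto
  have three := fun y hy => mem_triple_of_length hx ha hb hc hab hac hbc (y := y) hy
  have out : ∀ C : Finset ν, ∀ y ∈ nbr E x, ∀ z ∈ nbr E x, y ≠ z → y ∉ C → z ∉ C →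
      (a ∉ C ∧ b ∉ C) ∨ (a ∉ C ∧ c ∉ C) ∨ (b ∉ C ∧ c ∉ C) := by
    intro C y hy z hz h h1 h2
    have := three y hy
    have := three z hz
    grind
  unfold rulesThreeAt at hB
  by_cases hadj : b ∈ nbr E a
  · simp only [hadj, decide_true, cond_true] at hB
    by_cases h3 : 3 ≤ (nbr E c).length
    · simp only [h3, decide_true, cond_true, List.mem_singleton] at hB
      subst hB
      refine ⟨isBranching_nbr_cons hE x (by simpa using nodup_nbr) ?_,
        light_two (i := 3) (j := 3) hx.ge h3 (by norm_num [base])⟩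
      intro C hC y hy z hz h h1 h2
      refine ⟨_, List.mem_singleton_self _, C, hC, le_rfl, hC.mem_of_nbr ?_⟩
      have h4 := out C y hy z hz h h1 h2
      have h5 := hC _ (mem_nbr.1 hadj)
      tauto
    · simp [h3] at hB
  simp only [hadj, decide_false, cond_false] at hB
  by_cases h2 : 2 ≤ (inter (nbr E a) (nbr E b)).length
  · simp only [h2, decide_true, cond_true, List.mem_singleton] at hB
    subst hB
    refine ⟨isBranching_nbr_cons hE x (by simpa using nodup_inter nodup_nbr) ?_,
      light_two (i := 3) (j := 2) hx.ge h2 (by norm_num [base])⟩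
    intro C hC y hy z hz h h1 h2
    refine ⟨_, List.mem_singleton_self _, C, hC, le_rfl, fun q hq => ?_⟩
    obtain ⟨hq1, hq2⟩ := mem_inter.1 hq
    have h4 := out C y hy z hz h h1 h2
    by_cases haC : a ∈ C
    · exact hC.mem_of_nbr (x := b) (by tauto) q hq2
    · exact hC.mem_of_nbr haC q hq1
  simp only [h2, decide_false, cond_false] at hB
  by_cases h4 : 4 ≤ (nbr E a).length ∧ 6 ≤ (join [a] (join (nbr E b) (nbr E c))).length
  · simp only [h4.1, h4.2, decide_true, Bool.and_self, cond_true, List.mem_singleton] at hB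
    subst hB
    refine ⟨isBranching_nbr_cons hE x ?_ ?_, light_three hx.ge h4.1 h4.2⟩
    · simpa using ⟨nodup_nbr, nodup_join (by simp) (nodup_join nodup_nbr nodup_nbr)⟩
    intro C hC y hy z hz h h1 h2
    have h5 := out C y hy z hz h h1 h2
    by_cases haC : a ∈ C
    · refine ⟨join [a] (join (nbr E b) (nbr E c)), by simp, C, hC, le_rfl, fun q hq => ?_⟩
      have hbC : b ∉ C := by tauto
      have hcC : c ∉ C := by tauto
      simp only [mem_join, List.mem_singleton] at hq
      rcases hq with rfl | hq | hq
      · exact haC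
      · exact hC.mem_of_nbr hbC q hq
      · exact hC.mem_of_nbr hcC q hq
    · exact ⟨nbr E a, by simp, C, hC, le_rfl, hC.mem_of_nbr haC⟩
  · have : (decide (4 ≤ (nbr E a).length) &&
      decide (6 ≤ (join [a] (join (nbr E b) (nbr E c))).length)) = false := by
      simpa using h4
    simp [this] at hB

theorem isBranching_of_mem_rules (hE : Sym E) (hB : B ∈ rules E) : IsBranching E B ∧ Light B := by
  obtain ⟨x, hx, hB⟩ := List.mem_flatMap.1 hB
  unfold rulesAt at hB
  by_cases h5 : 5 ≤ (nbr E x).length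
  · simp only [h5, decide_true, cond_true, List.mem_singleton] at hB
    subst hB
    exact ⟨isBranching_vertex E x,
      light_two (i := 1) (j := 5) (by simp) h5 (by norm_num [base])⟩
  by_cases h1 : (nbr E x).length = 1
  · simp only [h1, decide_true, cond_true] at hB
    have : B = [nbr E x] := by simpa using hB
    subst this
    refine ⟨isBranching_nbr_cons hE x (by simp) ?_, light_one h1.ge⟩
    intro C hC y hy z hz h
    obtain ⟨u, hu⟩ := List.length_eq_one_iff.1 h1
    simp_all
  by_cases h2 : (nbr E x).length = 2
  · exact isBranching_of_mem_rulesTwo hE h2 (by simpa [h2] using hB)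
  by_cases h3 : (nbr E x).length = 3
  · exact isBranching_of_mem_rulesThree hE h3 (by simpa [h3] using hB)
  simp [h5, h1, h2, h3] at hB

theorem rulesAt_eq_nil (h : rules E = []) (hx : x ∈ verts E) : rulesAt E x = [] := by
  rw [rules, List.flatMap_eq_nil_iff] at h
  exact h x hx

/-- The rules for degrees 1, 2 and at least 5 leave no exception, in contrast to those for degree 3.
-/
theorem nbr_length_of_rules_eq_nil (h : rules E = []) (hx : x ∈ verts E) :
    (nbr E x).length = 3 ∨ (nbr E x).length = 4 := by
  have h0 := rulesAt_eq_nil h hx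
  have h1 := mem_verts_iff_length.1 hx
  by_contra hc
  have : (nbr E x).length = 1 ∨ (nbr E x).length = 2 ∨ 5 ≤ (nbr E x).length := by omega
  unfold rulesAt at h0
  rcases this with h2 | h2 | h2
  · simp [h2] at h0
  · simp only [h2, decide_true, cond_true, decide_false, cond_false, Nat.reduceLeDiff,
      OfNat.ofNat_ne_one] at h0
    obtain ⟨a, b, hab⟩ := List.length_eq_two.1 h2
    have hn : (nbr E x).Nodup := nodup_nbr
    rw [hab] at hn
    have hne : a ≠ b := by simpa using hn
    simp only [rulesTwo, List.flatMap_eq_nil_iff] at h0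
    have h3 := h0 a (by simp [hab]) b (by simp [hab])
    simp only [hne, decide_false, cond_false] at h3
    by_cases h4 : b ∈ nbr E a
    · simp [h4] at h3
    · by_cases h5 : (join (nbr E a) (nbr E b)).length ≤ 2 <;> simp [h4, h5] at h3
  · simp [h2] at h0

theorem mem_verts_of_mem_nbr (hE : Sym E) (hy : y ∈ nbr E x) : y ∈ verts E :=
  mem_verts.2 ⟨x, (hE _ _ (mem_nbr.1 hy)).1⟩

/-- The first two rules for degree 3 fail, so the neighbours of `x` are pairwise non-adjacent and
share only `x`. A neighbour of degree at least 4 would then trigger the third rule. -/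
theorem nbr_length_three_of_rules_eq_nil (hE : Sym E) (h : rules E = [])
    (hx : (nbr E x).length = 3) (hy : y ∈ nbr E x) : (nbr E y).length = 3 := by
  have hxv : x ∈ verts E := mem_verts_iff_length.2 (by omega)
  have h0 := rulesAt_eq_nil h hxv
  simp only [rulesAt, hx, decide_true, cond_true, decide_false, cond_false, Nat.reduceLeDiff,
      OfNat.ofNat_ne_one, Nat.reduceEqDiff] at h0
  have hd : ∀ z ∈ nbr E x, 3 ≤ (nbr E z).length := fun z hz => by
    have := nbr_length_of_rules_eq_nil h (mem_verts_of_mem_nbr hE hz); omega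
  have hrule : ∀ a ∈ nbr E x, ∀ b ∈ nbr E x, ∀ c ∈ nbr E x, a ≠ b → a ≠ c → b ≠ c →
      rulesThreeAt E (nbr E x) a b c = [] := by
    intro a ha b hb c hc h1 h2 h3
    simp only [rulesThree, List.flatMap_eq_nil_iff] at h0
    simpa [h1, h2, h3] using h0 a ha b hb c hc
  -- neighbours of `x` are not adjacent and have no further common neighbour
  have hfar : ∀ a ∈ nbr E x, ∀ b ∈ nbr E x, ∀ c ∈ nbr E x, a ≠ b → a ≠ c → b ≠ c →
      b ∉ nbr E a ∧ (inter (nbr E a) (nbr E b)).length < 2 := by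
    intro a ha b hb c hc h1 h2 h3
    have h4 := hrule a ha b hb c hc h1 h2 h3
    unfold rulesThreeAt at h4
    by_cases h5 : b ∈ nbr E a
    · simp [h5, hd c hc] at h4
    · refine ⟨h5, ?_⟩
      by_contra h6
      simp [h5, not_lt.1 h6] at h4
  obtain ⟨b, c, hb, hc, hab, hac, hbc⟩ : ∃ b c, b ∈ nbr E x ∧ c ∈ nbr E x ∧ y ≠ b ∧ y ≠ c ∧
      b ≠ c := by
    obtain ⟨u, v, w, hN⟩ := List.length_eq_three.1 hx
    have hn : (nbr E x).Nodup := nodup_nbr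
    rw [hN] at hn hy ⊢
    simp only [List.nodup_cons, List.mem_cons, List.not_mem_nil, or_false, not_or, not_false_eq_true,
      List.nodup_nil, and_true] at hn hy
    obtain ⟨⟨h1, h2⟩, h3⟩ := hn
    rcases hy with rfl | rfl | rfl
    · exact ⟨v, w, by simp, by simp, h1, h2, h3⟩
    · exact ⟨u, w, by simp, by simp, Ne.symm h1, h3, h2⟩
    · exact ⟨u, v, by simp, by simp, Ne.symm h2, Ne.symm h3, h1⟩
  by_contra hy3
  have hy4 : 4 ≤ (nbr E y).length := by have := hd y hy; omega
  have h1 := hfar y hy b hb c hc hab hac hbc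
  have h2 := hfar b hb c hc y hy hbc hab.symm hac.symm
  have h3 := hrule y hy b hb c hc hab hac hbc
  -- `b` and `c` have at least three neighbours each and at most one in common, which makes five;
  -- `y` is adjacent to neither and is the sixth.
  have h6 : 6 ≤ (join [y] (join (nbr E b) (nbr E c))).length := by
    have h7 : (nbr E b).length = (inter (nbr E b) (nbr E c)).length +
        ((nbr E b).filter fun z => !decide (z ∈ nbr E c)).length := by
      rw [inter]
      exact List.length_eq_length_filter_add _
    have h8 : ([y].filter fun z => !decide (z ∈ join (nbr E b) (nbr E c))).length = 1 := by
      have h9 : y ∉ nbr E b := fun h => (hfar b hb y hy c hc hab.symm hbc hac).1 h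
      have h10 : y ∉ nbr E c := fun h => (hfar c hc y hy b hb hac.symm hbc.symm hab).1 h
      have h11 : y ∉ join (nbr E b) (nbr E c) := by rw [mem_join]; tauto
      simp only [List.filter_cons, h11, decide_false, Bool.not_false, if_true, List.filter_nil,
        List.length_singleton]
    have h12 := hd b hb
    have h13 := hd c hc
    rw [join, List.length_append, h8, join, List.length_append]
    omega
  unfold rulesThreeAt at h3
  simp [h1.1, not_le.2 h1.2, hy4, h6] at h3

end VC

namespace VC

open Cost

variable {ν : Type} [DecidableEq ν]

/-! ### Components -/

/-- Add all neighbours to a set of vertices. -/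
def step (E : List (ν × ν)) (S : List ν) : List ν :=
  (verts E).filter fun v => decide (v ∈ S) || (nbr E v).any fun u => decide (u ∈ S)

/-- The vertices that can be reached from `x`. -/
def reach (E : List (ν × ν)) (x : ν) : List ν :=
  E.foldr (fun _ S => step E S) ((verts E).filter fun v => decide (v = x))

variable {E E' : List (ν × ν)} {x y z : ν} {S : List ν}

theorem mem_step : y ∈ step E S ↔ y ∈ verts E ∧ (y ∈ S ∨ ∃ u ∈ S, (y, u) ∈ E) := by
  simp only [step, List.mem_filter, Bool.or_eq_true, decide_eq_true_eq, List.any_eq_true, mem_nbr]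
  aesop

theorem mem_verts_right (hE : Sym E) (h : (x, y) ∈ E) : y ∈ verts E :=
  mem_verts.2 ⟨x, (hE _ _ h).1⟩

theorem reach_eq (E : List (ν × ν)) (x : ν) : reach E x =
    (step E)^[E.length] ((verts E).filter fun v => decide (v = x)) := by
  rw [reach, List.foldr_const]

theorem reach_induction {P : ν → Prop} (hx : P x) (h : ∀ u v, P u → (v, u) ∈ E → P v) :
    ∀ y ∈ reach E x, P y := by
  rw [reach_eq]
  generalize E.length = n
  induction n with
  | zero => intro y hy; simp at hy; exact hy.2 ▸ hx
  | succ n ih =>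
    intro y hy
    rw [Function.iterate_succ_apply', mem_step] at hy
    rcases hy.2 with hy | ⟨u, hu, hy⟩
    · exact ih y hy
    · exact h u y (ih u hu) hy

theorem length_verts_le : (verts E).length ≤ E.length :=
  (uniq_sublist _).length_le.trans (by simp)

/-- Each round that does not find a closed set adds a vertex, and there are at most as many vertices
as entries of the edge list, so `E.length` rounds suffice. -/
theorem reach_closed (hE : Sym E) (hx : x ∈ verts E) :
    x ∈ reach E x ∧ ∀ u ∈ reach E x, ∀ v, (u, v) ∈ E → v ∈ reach E x := by
  rw [reach_eq]
  set S₀ := (verts E).filter fun v => decide (v = x) with hS₀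
  have hx0 : x ∈ S₀ := by simp [hS₀, hx]
  -- After `n` rounds the set is closed under adjacency or has at least `n + 1` elements.
  have main : ∀ n, x ∈ (step E)^[n] S₀ ∧ (∀ u ∈ (step E)^[n] S₀, u ∈ verts E) ∧
      ((step E)^[n] S₀).Nodup ∧ ((∀ u ∈ (step E)^[n] S₀, ∀ v, (u, v) ∈ E → v ∈ (step E)^[n] S₀) ∨
        n + 1 ≤ ((step E)^[n] S₀).length) := by
    intro n
    induction n with
    | zero =>
      exact ⟨hx0, fun u hu => List.mem_of_mem_filter hu, (nodup_uniq _).filter _,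
        Or.inr (List.length_pos_of_mem hx0)⟩
    | succ n ih =>
      rw [Function.iterate_succ_apply']
      generalize (step E)^[n] S₀ = S at ih
      obtain ⟨h1, h2, h3, h4⟩ := ih
      have hsub : ∀ u ∈ S, u ∈ step E S := fun u hu => mem_step.2 ⟨h2 u hu, Or.inl hu⟩
      refine ⟨hsub x h1, fun u hu => (mem_step.1 hu).1, (nodup_uniq _).filter _, ?_⟩
      by_cases hc : ∀ u ∈ S, ∀ v, (u, v) ∈ E → v ∈ S
      · left
        have heq : ∀ u, u ∈ step E S → u ∈ S := by
          intro u hu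
          rcases (mem_step.1 hu).2 with h | ⟨w, hw, h⟩
          · exact h
          · exact hc w hw u (hE _ _ h).1
        exact fun u hu v huv => hsub v (hc u (heq u hu) v huv)
      · right
        have h5 := h4.resolve_left hc
        push Not at hc
        obtain ⟨u, hu, v, huv, hv⟩ := hc
        have hvs : v ∈ step E S :=
          mem_step.2 ⟨mem_verts_right hE huv, Or.inr ⟨u, hu, (hE _ _ huv).1⟩⟩
        have h6 : (v :: S).Subperm (step E S) := by
          refine (List.nodup_cons.2 ⟨hv, h3⟩).subperm ?_
          intro w hw
          rcases List.mem_cons.1 hw with rfl | hw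
          · exact hvs
          · exact hsub w hw
        have h7 := h6.length_le
        simp only [List.length_cons] at h7
        omega
  obtain ⟨h1, h2, h3, h4⟩ := main E.length
  refine ⟨h1, h4.resolve_right fun h => ?_⟩
  have h5 := (h3.subperm (l₂ := verts E) h2).length_le
  have h6 := length_verts_le (E := E)
  omega

/-- The edges inside a set of vertices that is closed under adjacency. -/
def inside (E : List (ν × ν)) (R : List ν) : List (ν × ν) := E.filter fun e => decide (e.1 ∈ R)

/-- The edges outside a set of vertices that is closed under adjacency. -/
def outside (E : List (ν × ν)) (R : List ν) : List (ν × ν) := E.filter fun e => !decide (e.1 ∈ R)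

theorem mem_inside {e : ν × ν} : e ∈ inside E S ↔ e ∈ E ∧ e.1 ∈ S := by simp [inside]

theorem mem_outside {e : ν × ν} : e ∈ outside E S ↔ e ∈ E ∧ e.1 ∉ S := by simp [outside]

theorem length_inside_add_length_outside (E : List (ν × ν)) (R : List ν) :
    (inside E R).length + (outside E R).length = E.length := by
  rw [inside, outside]
  exact (List.length_eq_length_filter_add _).symm

/-- No edge leaves `S`, so a cover splits into its parts inside and outside `S`, and covers of the
two parts can be united. -/
theorem tau_eq_add (hE : Sym E) (hS : ∀ u ∈ S, ∀ v, (u, v) ∈ E → v ∈ S) :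
    tau E = tau (inside E S) + tau (outside E S) := by
  apply le_antisymm
  · obtain ⟨C, hC, h⟩ := exists_isCover_card_eq_tau (inside E S)
    obtain ⟨D, hD, h'⟩ := exists_isCover_card_eq_tau (outside E S)
    have : IsCover E (C ∪ D) := by
      intro e he
      by_cases h1 : e.1 ∈ S
      · rcases hC e (mem_inside.2 ⟨he, h1⟩) with h | h <;> simp [h]
      · rcases hD e (mem_outside.2 ⟨he, h1⟩) with h | h <;> simp [h]
    have h1 := tau_le_card this
    have h2 := Finset.card_union_le C D
    omega
  · obtain ⟨C, hC, h⟩ := exists_isCover_card_eq_tau E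
    have h1 : tau (inside E S) ≤ (C.filter (· ∈ S)).card := by
      apply tau_le_card
      intro e he
      obtain ⟨he, h1⟩ := mem_inside.1 he
      have h2 := hS _ h1 e.2 he
      rcases hC e he with h | h <;> simp [h, h1, h2]
    have h2 : tau (outside E S) ≤ (C.filter (¬ · ∈ S)).card := by
      apply tau_le_card
      intro e he
      obtain ⟨he, h1⟩ := mem_outside.1 he
      have h2 : e.2 ∉ S := fun h => h1 (hS _ h e.1 (hE _ _ he).1)
      rcases hC e he with h | h <;> simp [h, h1, h2]
    have h3 := Finset.card_filter_add_card_filter_not (s := C) (· ∈ S)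
    omega

/-! ### The search tree -/

variable [Inhabited ν]

/-- The vertex at which a graph without rules is split or branched on. -/
def root (E : List (ν × ν)) : ν := (verts E).headD default

/-- The alternatives at a node of the search tree. -/
def expand (s : ℕ × List (ν × ν)) : List (ℕ × List (ℕ × List (ν × ν))) :=
  bif s.2.isEmpty then [(0, [])] else
  bif (rules s.2).isEmpty then
    (bif (outside s.2 (reach s.2 (root s.2))).isEmpty then
      alts s.1 s.2 [[root s.2], nbr s.2 (root s.2)] else
      [(0, [(s.1, inside s.2 (reach s.2 (root s.2))),
        (s.1, outside s.2 (reach s.2 (root s.2)))])]) else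
  alts s.1 s.2 ((rules s.2).headD [])

theorem root_mem (h : E ≠ []) : root E ∈ verts E := by
  have : verts E ≠ [] := by
    obtain ⟨e, he⟩ := List.exists_mem_of_ne_nil E h
    exact List.ne_nil_of_mem (mem_verts.2 ⟨e.2, he⟩)
  rw [root]
  obtain ⟨a, l, hl⟩ := List.exists_cons_of_ne_nil this
  simp [hl]

/-- The cases in the definition of `expand`. -/
theorem expand_cases (k : ℕ) (E : List (ν × ν)) :
    (E = [] ∧ expand (k, E) = [(0, [])]) ∨
    (E ≠ [] ∧ rules E ≠ [] ∧ ∃ B ∈ rules E, expand (k, E) = alts k E B) ∨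
    (E ≠ [] ∧ rules E = [] ∧ outside E (reach E (root E)) = [] ∧
      expand (k, E) = alts k E [[root E], nbr E (root E)]) ∨
    (E ≠ [] ∧ rules E = [] ∧ outside E (reach E (root E)) ≠ [] ∧
      expand (k, E) = [(0, [(k, inside E (reach E (root E))),
        (k, outside E (reach E (root E)))])]) := by
  by_cases h1 : E = []
  · exact Or.inl ⟨h1, by simp [expand, h1]⟩
  have e1 := List.isEmpty_eq_false_iff.2 h1
  by_cases h2 : rules E = []
  · by_cases h3 : outside E (reach E (root E)) = []
    · refine Or.inr (Or.inr (Or.inl ⟨h1, h2, h3, ?_⟩))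
      simp only [expand, e1, h2, h3, List.isEmpty_nil, cond_false, cond_true]
    · refine Or.inr (Or.inr (Or.inr ⟨h1, h2, h3, ?_⟩))
      have e3 := List.isEmpty_eq_false_iff.2 h3
      simp only [expand, e1, h2, e3, List.isEmpty_nil, cond_false, cond_true]
  · have e2 := List.isEmpty_eq_false_iff.2 h2
    refine Or.inr (Or.inl ⟨h1, h2, (rules E).headD [], ?_, ?_⟩)
    · obtain ⟨a, l, hl⟩ := List.exists_cons_of_ne_nil h2
      simp [hl]
    · simp only [expand, e1, e2, cond_false]

/-- Rules and vertex branchings are exact by `IsBranching.val_eq`. For a split, both parts keep the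
full budget, and capping each value before adding does not change the capped sum. -/
theorem val_expand (hE : Sym E) (k : ℕ) :
    val (k, E) = Search.combine val (k + 1) (expand (k, E)) := by
  rcases expand_cases k E with ⟨rfl, h⟩ | ⟨-, -, B, hB, h⟩ | ⟨-, -, -, h⟩ | ⟨h1, -, -, h⟩
  · have : tau ([] : List (ν × ν)) = 0 :=
      Nat.le_zero.1 (tau_le_card (C := ∅) (by intro e he; simp at he))
    rw [h]; simp [val, this, Search.combine]
  · rw [h]; exact (isBranching_of_mem_rules hE hB).1.val_eq k
  · rw [h]; exact (isBranching_vertex E _).val_eq k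
  · rw [h]
    have := tau_eq_add hE (reach_closed hE (root_mem h1)).2
    simp only [Search.combine, List.foldr_cons, List.foldr_nil, List.map_cons, List.map_nil,
      List.sum_cons, List.sum_nil, val]
    omega

/-- The children of a node are subgraphs, with at most the same budget. -/
theorem expand_child (hE : Sym E) {k : ℕ} {a : ℕ × List (ℕ × List (ν × ν))}
    (ha : a ∈ expand (k, E)) {s : ℕ × List (ν × ν)} (hs : s ∈ a.2) :
    s.1 ≤ k ∧ s.2.Sublist E ∧ Sym s.2 := by
  have halts : ∀ B, a ∈ alts k E B → s.1 ≤ k ∧ s.2.Sublist E ∧ Sym s.2 := by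
    intro B ha
    simp only [alts, List.mem_map] at ha
    obtain ⟨Q, -, rfl⟩ := ha
    simp only [List.mem_singleton] at hs
    subst hs
    exact ⟨Nat.sub_le _ _, del_sublist, hE.del⟩
  rcases expand_cases k E with ⟨rfl, h⟩ | ⟨-, -, B, hB, h⟩ | ⟨-, -, -, h⟩ | ⟨h1, -, -, h⟩
  · rw [h, List.mem_singleton] at ha
    subst ha; simp at hs
  · exact halts _ (h ▸ ha)
  · exact halts _ (h ▸ ha)
  · rw [h, List.mem_singleton] at ha
    subst ha
    have hc := (reach_closed hE (root_mem h1)).2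
    simp only [List.mem_cons, List.not_mem_nil, or_false] at hs
    rcases hs with rfl | rfl
    · exact ⟨le_rfl, List.filter_sublist, hE.filter fun u v h h' => by
        simp only [decide_eq_true_eq] at h' ⊢; exact hc u h' v h⟩
    · exact ⟨le_rfl, List.filter_sublist, hE.filter fun u v h h' => by
        simp only [Bool.not_eq_true', decide_eq_false_iff_not] at h' ⊢
        exact fun hv => h' (hc v hv u (hE _ _ h).1)⟩

/-! ### The size of the search tree -/

/-- All degrees are at most `d`, and no component is `d`-regular. -/
def Lev (d : ℕ) (E : List (ν × ν)) : Prop :=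
  (∀ x, (nbr E x).length ≤ d) ∧
    ∀ U : Finset ν, (∀ u ∈ U, (nbr E u).length = d ∧ ∀ v ∈ nbr E u, v ∈ U) → U = ∅

theorem nbr_subperm (h : ∀ e ∈ E', e ∈ E) (x : ν) : (nbr E' x).Subperm (nbr E x) :=
  nodup_nbr.subperm fun _ hy => mem_nbr.2 (h _ (mem_nbr.1 hy))

theorem mem_nbr_of_length (h : ∀ e ∈ E', e ∈ E) (hl : (nbr E x).length ≤ (nbr E' x).length)
    (hy : y ∈ nbr E x) : y ∈ nbr E' x :=
  ((nbr_subperm h x).perm_of_length_le hl).symm.subset hy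

/-- A vertex that still has degree `d` in the subgraph has lost no neighbour, so a `d`-regular
closed set of the subgraph is one of the whole graph. -/
theorem Lev.mono {d : ℕ} (hL : Lev d E) (h : ∀ e ∈ E', e ∈ E) : Lev d E' := by
  refine ⟨fun x => (nbr_subperm h x).length_le.trans (hL.1 x), fun U hU => hL.2 U fun u hu => ?_⟩
  have h1 := (nbr_subperm h u).length_le
  have h2 := hL.1 u
  have h3 := (hU u hu).1
  exact ⟨by omega, fun v hv => (hU u hu).2 v (mem_nbr_of_length h (by omega) hv)⟩

theorem lev_of_lt {d : ℕ} (h : ∀ x, (nbr E x).length < d) : Lev d E := by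
  refine ⟨fun x => (h x).le, fun U hU => ?_⟩
  rw [Finset.eq_empty_iff_forall_notMem]
  intro u hu
  have := (hU u hu).1
  have := h u
  omega

theorem Lev.succ {d : ℕ} (h : Lev d E) : Lev (d + 1) E := lev_of_lt fun x => Nat.lt_succ_of_le (h.1 x)

/-- With all degrees at most 3 and no rule, every vertex on an edge has degree 3, and these vertices
form a forbidden closed set. So below level 3 a rule always applies. -/
theorem not_lev_three (hE : Sym E) (h0 : E ≠ []) (h : rules E = []) : ¬ Lev 3 E := by
  intro hL
  have h1 := hL.2 (verts E).toFinset fun u hu => by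
    rw [List.mem_toFinset] at hu
    have h1 := nbr_length_of_rules_eq_nil h hu
    have h2 := hL.1 u
    exact ⟨by omega, fun v hv => by simpa using mem_verts_of_mem_nbr hE hv⟩
  have h2 := root_mem h0
  have : root E ∈ (verts E).toFinset := by simpa using h2
  simp [h1] at this

/-- Neighbours of degree-4 vertices have degree 4 again, so the degree-4 vertices form a closed
4-regular set, which level 4 excludes. -/
theorem nbr_length_of_lev_four (hE : Sym E) (h : rules E = []) (hL : Lev 4 E)
    (hx : x ∈ verts E) : (nbr E x).length = 3 := by
  refine (nbr_length_of_rules_eq_nil h hx).resolve_right fun h4 => ?_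
  have h1 := hL.2 ((verts E).toFinset.filter fun u => (nbr E u).length = 4) fun u hu => by
    simp only [Finset.mem_filter, List.mem_toFinset] at hu ⊢
    refine ⟨hu.2, fun v hv => ⟨mem_verts_of_mem_nbr hE hv, ?_⟩⟩
    refine (nbr_length_of_rules_eq_nil h (mem_verts_of_mem_nbr hE hv)).resolve_left fun h3 => ?_
    have := nbr_length_three_of_rules_eq_nil hE h h3 (mem_nbr.2 (hE _ _ (mem_nbr.1 hv)).1)
    omega
  have : x ∈ (verts E).toFinset.filter fun u => (nbr E u).length = 4 := by simp [hx, h4]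
  simp [h1] at this

/-- In a connected graph, a set that is closed under adjacency contains all vertices. -/
theorem connected (hE : Sym E) (hc : outside E (reach E x) = []) {P : ν → Prop}
    (hP : ∀ u v, P u → (u, v) ∈ E → P v) (hy : y ∈ verts E) (hPy : P y) (hz : z ∈ verts E) :
    P z := by
  have hr : ∀ u ∈ verts E, u ∈ reach E x := by
    intro u hu
    obtain ⟨v, hv⟩ := mem_verts.1 hu
    by_contra h
    have : (u, v) ∈ outside E (reach E x) := mem_outside.2 ⟨hv, h⟩
    simp [hc] at this
  by_cases hx : P x
  · exact reach_induction hx (fun u v hu h => hP u v hu (hE _ _ h).1) z (hr z hz)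
  · exact absurd hPy (reach_induction (P := fun u => ¬ P u) hx
      (fun u v hu h hv => hu (hP v u hv h)) y (hr y hy))

/-- Deleting a vertex from a connected `d`-regular graph destroys all `d`-regular components. -/
theorem lev_del {d : ℕ} (hd : d ≠ 0) (hE : Sym E) (hc : outside E (reach E x) = [])
    (hreg : ∀ u ∈ verts E, (nbr E u).length = d) {Q : List ν} (hz : z ∈ verts E) (hzQ : z ∈ Q) :
    Lev d (del E Q) := by
  have hsub : ∀ e ∈ del E Q, e ∈ E := fun e he => (mem_del.1 he).1
  have hle : ∀ u, (nbr E u).length ≤ d := by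
    intro u
    by_cases hu : u ∈ verts E
    · exact (hreg u hu).le
    · rw [mem_verts_iff_length] at hu; omega
  refine ⟨fun u => (nbr_subperm hsub u).length_le.trans (hle u), fun U hU => ?_⟩
  by_contra hne
  obtain ⟨u, hu⟩ := Finset.nonempty_iff_ne_empty.2 hne
  -- A regular set that survives the deletion has kept all its neighbours, so it is closed in `E`
  -- and contains `z` by connectedness; but `z` has become isolated.
  have hzU : z ∈ U := by
    refine connected hE hc (P := (· ∈ U)) ?_ (mem_verts_iff_length.2 ?_) hu hz
    · intro u v hu huv
      refine (hU u hu).2 v (mem_nbr_of_length hsub ?_ (mem_nbr.2 huv))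
      have := hle u
      have := (hU u hu).1
      omega
    · have h1 := (nbr_subperm hsub u).length_le
      have h2 := (hU u hu).1
      omega
  have h1 := (hU z hzU).1
  obtain ⟨v, hv⟩ := List.length_pos_iff_exists_mem.1 (by omega : 0 < (nbr (del E Q) z).length)
  exact (mem_del.1 (mem_nbr.1 hv)).2.1 hzQ

theorem regular_of_rules_eq_nil (hE : Sym E) (h0 : E ≠ []) (h : rules E = [])
    (hc : outside E (reach E x) = []) :
    ∃ d, (d = 3 ∨ d = 4) ∧ ∀ u ∈ verts E, (nbr E u).length = d := by
  have hr := root_mem h0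
  rcases nbr_length_of_rules_eq_nil h hr with h3 | h4
  · refine ⟨3, Or.inl rfl, fun u hu => ?_⟩
    exact connected hE hc (P := fun u => (nbr E u).length = 3)
      (fun u v hu huv => nbr_length_three_of_rules_eq_nil hE h hu (mem_nbr.2 huv)) hr h3 hu
  · by_cases hex : ∃ u ∈ verts E, (nbr E u).length = 3
    · obtain ⟨u, hu, hu3⟩ := hex
      have := connected hE hc (P := fun u => (nbr E u).length = 3)
        (fun u v hu huv => nbr_length_three_of_rules_eq_nil hE h hu (mem_nbr.2 huv)) hu hu3 hr
      omega
    · refine ⟨4, Or.inr rfl, fun u hu => ?_⟩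
      push Not at hex
      exact (nbr_length_of_rules_eq_nil h hu).resolve_left (hex u hu)

/-- The factor for the number of components. -/
def width (E : List (ν × ν)) : ℕ := max 1 (2 * E.length - 1)

open Classical in
/-- The coefficient in the bound on the number of nodes below a graph with at most `M` edges. -/
noncomputable def coef (M : ℕ) (E : List (ν × ν)) : ℝ :=
  if Lev 3 E then 5000 else if Lev 4 E then 15000 * width E else 75000 * M * width E

theorem one_le_width (E : List (ν × ν)) : (1 : ℝ) ≤ width E := by
  exact_mod_cast le_max_left _ _

theorem width_mono (h : E'.length ≤ E.length) : (width E' : ℝ) ≤ width E := by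
  have : width E' ≤ width E := by unfold width; omega
  exact_mod_cast this

/-! ### The coefficient at rule, splitting and branching nodes -/

section Coef

variable {M : ℕ}

theorem coef_of_lev_three (h : Lev 3 E) : coef M E = 5000 := by simp [coef, h]

theorem coef_le_of_lev_four (h : Lev 4 E) : coef M E ≤ 15000 * width E := by
  have := one_le_width E
  unfold coef
  split_ifs <;> linarith

theorem coef_le (hM : 1 ≤ M) (E : List (ν × ν)) : coef M E ≤ 75000 * M * width E := by
  have h1 := one_le_width E
  have h2 : (1 : ℝ) ≤ M := by exact_mod_cast hM
  have h3 : (1 : ℝ) * width E ≤ M * width E := by gcongr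
  unfold coef
  split_ifs <;> linarith

theorem le_coef (hM : 1 ≤ M) (E : List (ν × ν)) : 5000 ≤ coef M E := by
  have h1 := one_le_width E
  have h2 : (1 : ℝ) ≤ M := by exact_mod_cast hM
  have h3 : (1 : ℝ) * width E ≤ M * width E := by gcongr
  unfold coef
  split_ifs <;> linarith

theorem coef_mono (hM : 1 ≤ M) (h : E'.Sublist E) : coef M E' ≤ coef M E := by
  have hsub : ∀ e ∈ E', e ∈ E := fun e he => h.subset he
  have hw := width_mono h.length_le
  by_cases h3 : Lev 3 E
  · rw [coef_of_lev_three h3, coef_of_lev_three (h3.mono hsub)]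
  by_cases h4 : Lev 4 E
  · refine (coef_le_of_lev_four (h4.mono hsub)).trans ?_
    simp only [coef, h3, h4, if_false, if_true]
    linarith
  · refine (coef_le hM E').trans ?_
    simp only [coef, h3, h4, if_false]
    gcongr

/-- The width 2m - 1 of m ≥ 1 edges is superadditive with one unit to spare, which pays for the
splitting node. Level 3 is excluded because its coefficient is constant. -/
theorem coef_inside_add_coef_outside (hM : 1 ≤ M) (h3 : ¬ Lev 3 E) (R : List ν)
    (hi : inside E R ≠ []) (ho : outside E R ≠ []) :
    coef M (inside E R) + coef M (outside E R) + 1 ≤ coef M E := by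
  have hlen := length_inside_add_length_outside E R
  have h1 := List.length_pos_iff.2 hi
  have h2 := List.length_pos_iff.2 ho
  have hw : (width (inside E R) : ℝ) + width (outside E R) + 1 ≤ width E := by
    have : width (inside E R) + width (outside E R) + 1 ≤ width E := by unfold width; omega
    exact_mod_cast this
  have hM' : (1 : ℝ) ≤ M := by exact_mod_cast hM
  by_cases h4 : Lev 4 E
  · have h5 := coef_le_of_lev_four (M := M) (h4.mono (E' := inside E R) fun e he => (mem_inside.1 he).1)
    have h6 := coef_le_of_lev_four (M := M) (h4.mono (E' := outside E R) fun e he => (mem_outside.1 he).1)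
    simp only [coef, h3, h4, if_false, if_true] at h5 h6 ⊢
    linarith
  · have h5 := coef_le hM (inside E R)
    have h6 := coef_le hM (outside E R)
    have h7 := mul_le_mul_of_nonneg_left hw (by positivity : (0 : ℝ) ≤ 75000 * M)
    have h8 : coef M E = 75000 * M * width E := by simp [coef, h3, h4]
    rw [h8]
    linarith

/-- Branching at a connected regular graph lowers the level, and the constants of consecutive levels
leave room for two children: 2 · 5000 + 1 ≤ 15000 and, as the width is at most 2M, 2 · 15000 · 2M +
1 ≤ 75000 M. -/
theorem coef_del (hM : E.length ≤ M) (hE : Sym E) (h0 : E ≠ []) (h : rules E = [])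
    (hc : outside E (reach E x) = []) {Q : List ν} (hz : z ∈ verts E) (hzQ : z ∈ Q) :
    2 * coef M (del E Q) + 1 ≤ coef M E := by
  have h3 := not_lev_three hE h0 h
  have hw := one_le_width E
  have h1 := List.length_pos_iff.2 h0
  by_cases h4 : Lev 4 E
  · have h5 := lev_del three_ne_zero hE hc (fun u hu => nbr_length_of_lev_four hE h h4 hu) hz hzQ
    rw [coef_of_lev_three h5]
    simp only [coef, h3, h4, if_false, if_true]
    linarith
  · obtain ⟨d, hd, hreg⟩ := regular_of_rules_eq_nil hE h0 h hc
    have h5 := lev_del (by omega) hE hc hreg hz hzQ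
    have h6 : Lev 4 (del E Q) := by
      rcases hd with rfl | rfl
      · exact h5.succ
      · exact h5
    have h7 := coef_le_of_lev_four (M := M) h6
    have h8 : (width (del E Q) : ℝ) ≤ 2 * M := by
      have h9 : (del E Q).length ≤ E.length := del_sublist.length_le
      have : width (del E Q) ≤ 2 * M := by unfold width; omega
      exact_mod_cast this
    have h9 : (1 : ℝ) ≤ M := by exact_mod_cast (by omega : 1 ≤ M)
    have h10 : (M : ℝ) * 1 ≤ M * width E := by gcongr
    have h11 : coef M E = 75000 * M * width E := by simp [coef, h3, h4]
    rw [h11]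
    linarith

end Coef

/-- The bound on the number of nodes of the search tree. -/
noncomputable def nodes (M : ℕ) (s : ℕ × List (ν × ν)) : ℝ := coef M s.2 * base ^ s.1

theorem one_le_base_pow (k : ℕ) : 1 ≤ base ^ k := one_le_pow₀ (by norm_num [base])

theorem base_pow_sub {k j : ℕ} (h : j ≤ k) : base ^ (k - j) = base ^ k * base⁻¹ ^ j := by
  have hb : base ≠ 0 := by norm_num [base]
  rw [inv_pow, ← div_eq_mul_inv, eq_div_iff (pow_ne_zero _ hb), ← pow_add, Nat.sub_add_cancel h]

theorem sum_alts_le {M k : ℕ} {c : ℝ} (hc : 0 ≤ c) (B : List (List ν))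
    (h : ∀ Q ∈ B, coef M (del E Q) ≤ c) :
    ((alts k E B).map fun x => (x.2.map (nodes M)).sum).sum ≤
      c * base ^ k * (B.map fun Q => base⁻¹ ^ Q.length).sum := by
  have hb : (0 : ℝ) < base := by norm_num [base]
  induction B with
  | nil => simp [alts]
  | cons Q B ih =>
    have ih := ih fun Q hQ => h Q (by simp [hQ])
    have hQ := h Q (by simp)
    have hp : 0 ≤ c * base ^ k * base⁻¹ ^ Q.length := by positivity
    simp only [List.map_cons, List.sum_cons, mul_add]
    by_cases hk : Q.length ≤ k
    · have : alts k E (Q :: B) = (Q.length, [(k - Q.length, del E Q)]) :: alts k E B := by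
        simp [alts, hk]
      rw [this]
      simp only [List.map_cons, List.map_nil, List.sum_cons, List.sum_nil, add_zero, nodes]
      rw [base_pow_sub hk, mul_assoc c]
      have : coef M (del E Q) * (base ^ k * base⁻¹ ^ Q.length) ≤
          c * (base ^ k * base⁻¹ ^ Q.length) := by gcongr
      linarith
    · have : alts k E (Q :: B) = alts k E B := by simp [alts, hk]
      rw [this]
      linarith

theorem nodes_expand {M : ℕ} (hM : 1 ≤ M) (hE : Sym E) (hl : E.length ≤ M) (k : ℕ) :
    ((expand (k, E)).map fun x => (x.2.map (nodes M)).sum).sum + 1 ≤ nodes M (k, E) := by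
  have hp := one_le_base_pow k
  have h5 := le_coef hM E
  -- A bound of at least 5000 turns the relative slack 1/5000 of a rule into the one unit needed for
  -- the node itself.
  have hcp : 5000 * base ^ k ≤ coef M E * base ^ k := by gcongr
  rcases expand_cases k E with ⟨-, h⟩ | ⟨-, -, B, hB, h⟩ | ⟨h0, hr, hc, h⟩ | ⟨h0, hr, hc, h⟩
  · rw [h]
    simp only [List.map_cons, List.map_nil, List.sum_nil, List.sum_cons, nodes]
    linarith
  · rw [h]
    have h1 := sum_alts_le (k := k) (by linarith : 0 ≤ coef M E) B
      fun Q _ => coef_mono hM (del_sublist (E := E) (Q := Q))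
    have h2 := (isBranching_of_mem_rules hE hB).2
    have h3 := mul_le_mul_of_nonneg_left h2 (by positivity : 0 ≤ coef M E * base ^ k)
    simp only [nodes]
    linarith
  · rw [h]
    have hz := root_mem h0
    obtain ⟨y, hy⟩ := List.length_pos_iff_exists_mem.1 (mem_verts_iff_length.1 hz)
    -- Here the decrease of the budget is ignored: two children with half of `coef M E - 1` each are
    -- paid for by the drop of the coefficient.
    have h1 := sum_alts_le (M := M) (E := E) (k := k) (c := (coef M E - 1) / 2) (by linarith)
      [[root E], nbr E (root E)] ?_
    · have h2 : ∀ n : ℕ, base⁻¹ ^ n ≤ 1 := fun n =>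
        pow_le_one₀ (by norm_num [base]) (by norm_num [base])
      have h3 := h2 [root E].length
      have h4 := h2 (nbr E (root E)).length
      simp only [List.map_cons, List.map_nil, List.sum_cons, List.sum_nil] at h1
      have h6 : (coef M E - 1) / 2 * base ^ k * (base⁻¹ ^ [root E].length +
          (base⁻¹ ^ (nbr E (root E)).length + 0)) ≤ (coef M E - 1) / 2 * base ^ k * 2 := by
        have : 0 ≤ (coef M E - 1) / 2 := by linarith
        apply mul_le_mul_of_nonneg_left _ (by positivity)
        linarith
      simp only [nodes]
      linarith
    · intro Q hQ
      simp only [List.mem_cons, List.not_mem_nil, or_false] at hQ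
      rcases hQ with rfl | rfl
      · have := coef_del (x := root E) hl hE h0 hr hc hz (List.mem_singleton_self _)
        linarith
      · have := coef_del (x := root E) hl hE h0 hr hc (mem_verts_of_mem_nbr hE hy) hy
        linarith
  · rw [h]
    have hz := root_mem h0
    obtain ⟨y, hy⟩ := mem_verts.1 hz
    have hi : inside E (reach E (root E)) ≠ [] :=
      List.ne_nil_of_mem (mem_inside.2 ⟨hy, (reach_closed hE hz).1⟩)
    have h1 := coef_inside_add_coef_outside hM (not_lev_three hE h0 hr) _ hi hc
    have h2 := mul_le_mul_of_nonneg_right h1 (by positivity : 0 ≤ base ^ k)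
    simp only [List.map_cons, List.map_nil, List.sum_nil, List.sum_cons, nodes]
    linarith

end VC

/-! ### Polynomial time for the expansion of nodes -/

namespace Cost.PolyF

open Enc

variable {α β γ : Type} [Enc α] [Enc β] [Enc γ]

theorem fst' {f : α → β × γ} (hf : PolyF f) : PolyF (fun a => (f a).1) := fst.comp hf

theorem snd' {f : α → β × γ} (hf : PolyF f) : PolyF (fun a => (f a).2) := snd.comp hf

end Cost.PolyF

namespace VC

open Cost

/-- Equality is decidable in polynomial time. -/
class PolyEq (ν : Type) [DecidableEq ν] [Enc ν] : Prop where
  eq : PolyF (fun x : ν × ν => decide (x.1 = x.2))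

instance : PolyEq ℕ := ⟨PolyF.fst.natEq PolyF.snd⟩

instance {α β : Type} [DecidableEq α] [DecidableEq β] [Enc α] [Enc β] [PolyEq α] [PolyEq β] :
    PolyEq (α × β) :=
  ⟨((PolyEq.eq.comp (PolyF.fst.fst'.pair PolyF.snd.fst')).and
    (PolyEq.eq.comp (PolyF.fst.snd'.pair PolyF.snd.snd'))).congr fun a => by
      rw [Bool.eq_iff_iff]; simp [Prod.ext_iff]⟩

variable {ν : Type} [DecidableEq ν] [Enc ν] [PolyEq ν] {α β : Type} [Enc α] [Enc β]

theorem polyF_eq {f g : α → ν} (hf : PolyF f) (hg : PolyF g) :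
    PolyF (fun a => decide (f a = g a)) := PolyEq.eq.comp (hf.pair hg)

theorem polyF_mem {f : α → ν} {l : α → List ν} (hf : PolyF f) (hl : PolyF l) :
    PolyF (fun a => decide (f a ∈ l a)) := PolyF.mem PolyEq.eq hf hl

theorem polyF_uniq {l : α → List ν} (hl : PolyF l) : PolyF (fun a => uniq (l a)) := by
  refine PolyF.foldr (b := fun _ => []) (g := fun _ x r => bif decide (x ∈ r) then r else x :: r)
    hl (PolyF.const []) ?_ ?_
  · exact (polyF_mem PolyF.snd.fst' PolyF.snd.snd').cond PolyF.snd.snd'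
      (PolyF.snd.fst'.cons PolyF.snd.snd')
  · obtain ⟨q, hq⟩ := hl.size_bound
    exact ⟨q, fun a l' h => (sz_sublist ((uniq_sublist l').trans h.sublist)).trans (hq a)⟩

theorem polyF_join {f g : α → List ν} (hf : PolyF f) (hg : PolyF g) :
    PolyF (fun a => join (f a) (g a)) :=
  (hf.filter (p := fun a x => !decide (x ∈ g a))
    (polyF_mem PolyF.snd (hg.comp PolyF.fst)).not).append hg

theorem polyF_inter {f g : α → List ν} (hf : PolyF f) (hg : PolyF g) :
    PolyF (fun a => inter (f a) (g a)) :=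
  hf.filter (p := fun a x => decide (x ∈ g a)) (polyF_mem PolyF.snd (hg.comp PolyF.fst))

theorem polyF_verts {E : α → List (ν × ν)} (hE : PolyF E) : PolyF (fun a => verts (E a)) :=
  polyF_uniq (hE.map (g := fun _ e => e.1) PolyF.snd.fst')

theorem polyF_nbr {E : α → List (ν × ν)} {x : α → ν} (hE : PolyF E) (hx : PolyF x) :
    PolyF (fun a => nbr (E a) (x a)) :=
  polyF_uniq ((hE.filter (p := fun a e => decide (e.1 = x a))
    (polyF_eq PolyF.snd.fst' (hx.comp PolyF.fst))).map (g := fun _ e => e.2) PolyF.snd.snd')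

theorem polyF_del {E : α → List (ν × ν)} {Q : α → List ν} (hE : PolyF E) (hQ : PolyF Q) :
    PolyF (fun a => del (E a) (Q a)) :=
  hE.filter (p := fun a (e : ν × ν) => !(decide (e.1 ∈ Q a) || decide (e.2 ∈ Q a)))
    ((polyF_mem PolyF.snd.fst' (hQ.comp PolyF.fst)).or
      (polyF_mem PolyF.snd.snd' (hQ.comp PolyF.fst))).not

theorem polyF_alts {k : α → ℕ} {E : α → List (ν × ν)} {B : α → List (List ν)} (hk : PolyF k)
    (hE : PolyF E) (hB : PolyF B) : PolyF (fun a => alts (k a) (E a) (B a)) :=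
  (hB.filter (p := fun a Q => decide (Q.length ≤ k a))
    (PolyF.snd.length.natLe (hk.comp PolyF.fst))).map
    (g := fun a (Q : List ν) => (Q.length, [(k a - Q.length, del (E a) Q)]))
    (PolyF.snd.length.pair (PolyF.singleton (((hk.comp PolyF.fst).natSub PolyF.snd.length).pair
      (polyF_del (hE.comp PolyF.fst) PolyF.snd))))

theorem polyF_rulesTwo :
    PolyF (fun x : List (ν × ν) × List ν => rulesTwo x.1 x.2) := by
  have hE : PolyF (fun x : ((List (ν × ν) × List ν) × ν) × ν => x.1.1.1) := PolyF.fst.fst'.fst'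
  have hN : PolyF (fun x : ((List (ν × ν) × List ν) × ν) × ν => x.1.1.2) := PolyF.fst.fst'.snd'
  have ha : PolyF (fun x : ((List (ν × ν) × List ν) × ν) × ν => x.1.2) := PolyF.fst.snd'
  have hU := polyF_join (polyF_nbr hE ha) (polyF_nbr hE PolyF.snd)
  have h1 := polyF_mem PolyF.snd (polyF_nbr hE ha)
  have h2 := hU.length.natLe (PolyF.const 2)
  refine PolyF.snd.flatMap (PolyF.fst.snd'.flatMap ((polyF_eq ha PolyF.snd).cond (PolyF.const [])
    (h1.cond hN.singleton.singleton (h2.cond hU.singleton.singleton ?_))))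
  exact (hN.cons hU.singleton).singleton

theorem polyF_rulesThreeAt :
    PolyF (fun x : (List (ν × ν) × List ν) × ν × ν × ν =>
      rulesThreeAt x.1.1 x.1.2 x.2.1 x.2.2.1 x.2.2.2) := by
  have hE : PolyF (fun x : (List (ν × ν) × List ν) × ν × ν × ν => x.1.1) := PolyF.fst.fst'
  have hN : PolyF (fun x : (List (ν × ν) × List ν) × ν × ν × ν => x.1.2) := PolyF.fst.snd'
  have ha : PolyF (fun x : (List (ν × ν) × List ν) × ν × ν × ν => x.2.1) := PolyF.snd.fst'
  have hb : PolyF (fun x : (List (ν × ν) × List ν) × ν × ν × ν => x.2.2.1) := PolyF.snd.snd'.fst'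
  have hc : PolyF (fun x : (List (ν × ν) × List ν) × ν × ν × ν => x.2.2.2) := PolyF.snd.snd'.snd'
  have hNa := polyF_nbr hE ha
  have hNb := polyF_nbr hE hb
  have hNc := polyF_nbr hE hc
  have hU := polyF_join ha.singleton (polyF_join hNb hNc)
  have hI := polyF_inter hNa hNb
  have h1 := polyF_mem hb hNa
  have h2 := (PolyF.const 3).natLe hNc.length
  have h3 := (PolyF.const 2).natLe hI.length
  have h4 := ((PolyF.const 4).natLe hNa.length).and ((PolyF.const 6).natLe hU.length)
  have r1 := (hN.cons hNc.singleton).singleton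
  have r2 := (hN.cons hI.singleton).singleton
  have r3 := (hN.cons (hNa.cons hU.singleton)).singleton
  exact h1.cond (h2.cond r1 (PolyF.const [])) (h3.cond r2 (h4.cond r3 (PolyF.const [])))

theorem polyF_rulesThree :
    PolyF (fun x : List (ν × ν) × List ν => rulesThree x.1 x.2) := by
  have h := polyF_rulesThreeAt (ν := ν)
  refine PolyF.snd.flatMap (PolyF.snd.comp PolyF.fst |>.flatMap
    ((PolyF.snd.comp (PolyF.fst.comp PolyF.fst)).flatMap (PolyF.cond ?_ (PolyF.const []) ?_)))
  · apply_rules [polyF_eq, PolyF.or, PolyF.fst', PolyF.snd', PolyF.id]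
  · exact h.comp (PolyF.fst.fst'.fst'.pair (PolyF.fst.fst'.snd'.pair
      (PolyF.fst.snd'.pair PolyF.snd)))

theorem polyF_rules : PolyF (fun E : List (ν × ν) => rules E) := by
  unfold rules
  refine (polyF_verts PolyF.id).flatMap ?_
  unfold rulesAt
  have hN : PolyF (fun x : List (ν × ν) × ν => nbr x.1 x.2) := polyF_nbr PolyF.fst PolyF.snd
  have h1 := hN.length.natEq (PolyF.const 1)
  have h2 := hN.length.natEq (PolyF.const 2)
  have h3 := hN.length.natEq (PolyF.const 3)
  have h5 := (PolyF.const 5).natLe hN.length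
  refine h5.cond ?_ (h1.cond ?_ (h2.cond ?_ (h3.cond ?_ (PolyF.const []))))
  · exact PolyF.singleton ((PolyF.snd.singleton).cons hN.singleton)
  · exact hN.singleton.singleton
  · have h := (polyF_rulesTwo (ν := ν)).comp (PolyF.fst.pair hN)
    exact h
  · have h := (polyF_rulesThree (ν := ν)).comp (PolyF.fst.pair hN)
    exact h

theorem polyF_reach : PolyF (fun x : List (ν × ν) × ν => reach x.1 x.2) := by
  unfold reach
  have hV : PolyF (fun x : List (ν × ν) × ν => verts x.1) := polyF_verts PolyF.fst
  refine PolyF.foldr (g := fun (x : List (ν × ν) × ν) (_ : ν × ν) S => step x.1 S) PolyF.fst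
    (hV.filter (polyF_eq PolyF.snd PolyF.fst.snd')) ?_ ?_
  · unfold step
    refine (hV.comp PolyF.fst).filter ((polyF_mem PolyF.snd PolyF.fst.snd'.snd').or
      ((polyF_nbr PolyF.fst.fst'.fst' PolyF.snd).any
        (polyF_mem PolyF.snd PolyF.fst.fst'.snd'.snd')))
  -- Every intermediate set is a sublist of the list of vertices.
  · obtain ⟨q, hq⟩ := hV.size_bound
    refine ⟨q, fun x l' _ => (sz_sublist ?_).trans (hq x)⟩
    cases l' with
    | nil => exact List.filter_sublist
    | cons e l' => exact List.filter_sublist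

theorem polyF_expand [Inhabited ν] :
    PolyF (fun s : ℕ × List (ν × ν) => expand s) := by
  have hr : PolyF (fun s : ℕ × List (ν × ν) => root s.2) :=
    (polyF_verts PolyF.snd).headD default
  have hR : PolyF (fun s : ℕ × List (ν × ν) => reach s.2 (root s.2)) :=
    polyF_reach.comp (PolyF.snd.pair hr)
  have hi : PolyF (fun s : ℕ × List (ν × ν) => inside s.2 (reach s.2 (root s.2))) :=
    PolyF.snd.filter (polyF_mem PolyF.snd.fst' (hR.comp PolyF.fst))
  have ho : PolyF (fun s : ℕ × List (ν × ν) => outside s.2 (reach s.2 (root s.2))) :=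
    PolyF.snd.filter (polyF_mem PolyF.snd.fst' (hR.comp PolyF.fst)).not
  have hrules : PolyF (fun s : ℕ × List (ν × ν) => rules s.2) := polyF_rules.comp PolyF.snd
  unfold expand
  exact PolyF.snd.isEmpty.cond (PolyF.const [(0, [])]) (hrules.isEmpty.cond
    (ho.isEmpty.cond
      (polyF_alts PolyF.fst PolyF.snd
        (hr.singleton.cons (polyF_nbr PolyF.snd hr).singleton))
      (PolyF.singleton ((PolyF.const 0).pair
        ((PolyF.fst.pair hi).cons (PolyF.fst.pair ho).singleton))))
    (polyF_alts PolyF.fst PolyF.snd (hrules.headD [])))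

end VC

namespace DPVC

open Cost VC

/-! ### Reduction to Vertex Cover: every vertex is replaced by a copy for every unit of power -/

/-- The entries of a matrix, with their positions. -/
def entries (rows : List (List ℕ)) : List ((ℕ × ℕ) × ℕ) :=
  rows.zipIdx.flatMap fun r => r.1.zipIdx.map fun c => ((r.2, c.2), c.1)

/-- The edges between the copies of the vertices; `U` has as many elements as there are copies. -/
def blow (rows : List (List ℕ)) (U : List ℕ) : List ((ℕ × ℕ) × (ℕ × ℕ)) :=
  (entries rows).flatMap fun a => (entries rows).flatMap fun b =>
    bif decide (b.1 = (a.1.2, a.1.1)) then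
      U.zipIdx.flatMap fun i => U.zipIdx.flatMap fun j =>
        bif decide (i.2 < a.2) && decide (j.2 < b.2) then [((a.1.1, i.2), (a.1.2, j.2))] else []
    else []

theorem polyF_entries : PolyF entries :=
  PolyF.id.zipIdx.flatMap (PolyF.snd.fst'.zipIdx.map
    ((PolyF.fst.snd'.snd'.pair PolyF.snd.snd').pair PolyF.snd.fst'))

theorem polyF_blow : PolyF (fun x : List (List ℕ) × List ℕ => blow x.1 x.2) := by
  have h := polyF_entries.comp (PolyF.fst (α := List (List ℕ)) (β := List ℕ))
  refine h.flatMap ((h.comp PolyF.fst).flatMap (PolyF.cond ?_ ?_ (PolyF.const [])))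
  · exact polyF_eq PolyF.snd.fst' (PolyF.fst.snd'.fst'.snd'.pair PolyF.fst.snd'.fst'.fst')
  · refine PolyF.fst.fst'.snd'.zipIdx.flatMap (PolyF.fst.fst'.fst'.snd'.zipIdx.flatMap
      (PolyF.cond ?_ ?_ (PolyF.const [])))
    · exact (PolyF.fst.snd'.snd'.natLt PolyF.fst.fst'.fst'.snd'.snd').and
        (PolyF.snd.snd'.natLt PolyF.fst.fst'.snd'.snd')
    · exact ((PolyF.fst.fst'.fst'.snd'.fst'.fst'.pair PolyF.fst.snd'.snd').pair
        (PolyF.fst.fst'.fst'.snd'.fst'.snd'.pair PolyF.snd.snd')).singleton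

theorem mem_entries {rows : List (List ℕ)} {u v a : ℕ} :
    ((u, v), a) ∈ entries rows ↔ ∃ r, rows[u]? = some r ∧ r[v]? = some a := by
  simp only [entries, List.mem_flatMap, List.mem_map, Prod.exists, Prod.mk.injEq,
    List.mem_zipIdx_iff_getElem?]
  aesop

theorem exists_mem_zipIdx {U : List ℕ} {i : ℕ} : (∃ x, (x, i) ∈ U.zipIdx) ↔ i < U.length := by
  simp only [List.mem_zipIdx_iff_getElem?]
  constructor
  · rintro ⟨x, hx⟩; exact (List.getElem?_eq_some_iff.1 hx).1
  · intro h; exact ⟨U[i], by simp [h]⟩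

theorem mem_blow {rows : List (List ℕ)} {U : List ℕ} {u v i j : ℕ} :
    ((u, i), (v, j)) ∈ blow rows U ↔ i < U.length ∧ j < U.length ∧
      ∃ a b, ((u, v), a) ∈ entries rows ∧ ((v, u), b) ∈ entries rows ∧ i < a ∧ j < b := by
  simp only [blow, List.mem_flatMap]
  constructor
  · rintro ⟨⟨⟨u', v'⟩, a⟩, ha, ⟨⟨v'', u''⟩, b⟩, hb, h⟩
    by_cases hvu : (v'', u'') = (v', u')
    · simp only [hvu, decide_true, cond_true, List.mem_flatMap] at h
      obtain ⟨⟨x, i'⟩, hi, ⟨y, j'⟩, hj, h⟩ := h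
      by_cases hij : i' < a ∧ j' < b
      · simp only [hij.1, hij.2, decide_true, Bool.and_self, cond_true, List.mem_singleton,
          Prod.mk.injEq] at h hvu
        obtain ⟨⟨rfl, rfl⟩, rfl, rfl⟩ := h
        obtain ⟨rfl, rfl⟩ := hvu
        exact ⟨exists_mem_zipIdx.1 ⟨x, hi⟩, exists_mem_zipIdx.1 ⟨y, hj⟩, a, b, ha, hb, hij⟩
      · have : (decide (i' < a) && decide (j' < b)) = false := by simpa using hij
        simp [this] at h
    · simp [hvu] at h
  · rintro ⟨hi, hj, a, b, ha, hb, hia, hjb⟩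
    obtain ⟨x, hx⟩ := exists_mem_zipIdx.2 hi
    obtain ⟨y, hy⟩ := exists_mem_zipIdx.2 hj
    refine ⟨_, ha, _, hb, ?_⟩
    simp only [decide_true, cond_true, List.mem_flatMap]
    exact ⟨_, hx, _, hy, by simp [hia, hjb]⟩

open Classical in
/-- The matrix of demands. -/
noncomputable def Inst.rows (I : Inst) : List (List ℕ) :=
  List.ofFn fun u => List.ofFn fun v => if I.G.Adj u v then I.w u v else 0

variable (I : Inst)

theorem Inst.encode_eq (P : ℕ) : I.encode P = Enc.enc (I.rows, P) := by
  have h : ∀ l : List ℕ, Enc.enc l = Val.ofList (l.map Val.num) := fun _ => rfl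
  have h' : ∀ l : List (List ℕ), Enc.enc l = Val.ofList (l.map Enc.enc) := fun _ => rfl
  rw [enc_prod, enc_nat, h', Inst.rows, List.map_ofFn, Inst.encode]
  congr 3
  funext u
  rw [Function.comp, h, List.map_ofFn]
  rfl

open Classical in
theorem Inst.mem_entries_rows {u v a : ℕ} : ((u, v), a) ∈ entries I.rows ↔
    ∃ (hu : u < I.n) (hv : v < I.n),
      a = if I.G.Adj ⟨u, hu⟩ ⟨v, hv⟩ then I.w ⟨u, hu⟩ ⟨v, hv⟩ else 0 := by
  rw [mem_entries, Inst.rows]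
  constructor
  · rintro ⟨r, hr, ha⟩
    simp only [List.getElem?_ofFn, Option.dite_none_right_eq_some, Option.some.injEq] at hr
    obtain ⟨hu, rfl⟩ := hr
    simp only [List.getElem?_ofFn, Option.dite_none_right_eq_some, Option.some.injEq] at ha
    obtain ⟨hv, rfl⟩ := ha
    exact ⟨hu, hv, rfl⟩
  · rintro ⟨hu, hv, rfl⟩
    exact ⟨_, by simp [hu]; rfl, by simp [hv]⟩

/-- The graph on the copies of the vertices. -/
noncomputable def Inst.graph (U : List ℕ) : List ((ℕ × ℕ) × (ℕ × ℕ)) := blow I.rows U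

theorem Inst.mem_graph {U : List ℕ} {u v i j : ℕ} : ((u, i), (v, j)) ∈ I.graph U ↔
    i < U.length ∧ j < U.length ∧ ∃ (hu : u < I.n) (hv : v < I.n),
      I.G.Adj ⟨u, hu⟩ ⟨v, hv⟩ ∧ i < I.w ⟨u, hu⟩ ⟨v, hv⟩ ∧ j < I.w ⟨v, hv⟩ ⟨u, hu⟩ := by
  rw [Inst.graph, mem_blow]
  simp only [I.mem_entries_rows]
  refine and_congr_right fun _ => and_congr_right fun _ => ⟨?_, ?_⟩
  · rintro ⟨a, b, ⟨hu, hv, rfl⟩, ⟨_, _, rfl⟩, hi, hj⟩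
    refine ⟨hu, hv, ?_⟩
    by_cases h : I.G.Adj ⟨u, hu⟩ ⟨v, hv⟩
    · simp only [h, h.symm, if_true] at hi hj
      exact ⟨h, hi, hj⟩
    · simp [h] at hi
  · rintro ⟨hu, hv, h, hi, hj⟩
    exact ⟨_, _, ⟨hu, hv, rfl⟩, ⟨hv, hu, rfl⟩, by simpa [h] using hi, by simpa [h.symm] using hj⟩

theorem Inst.sym_graph (U : List ℕ) : Sym (I.graph U) := by
  rintro ⟨u, i⟩ ⟨v, j⟩ h
  obtain ⟨hi, hj, hu, hv, hadj, h1, h2⟩ := I.mem_graph.1 h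
  refine ⟨I.mem_graph.2 ⟨hj, hi, hv, hu, hadj.symm, h2, h1⟩, ?_⟩
  rintro ⟨⟩
  exact hadj.ne rfl

/-- The reduction is correct. -/
theorem Inst.tau_graph_le_iff {P : ℕ} {U : List ℕ} (hU : U.length = P + 1) :
    tau (I.graph U) ≤ P ↔ I.Solvable P := by
  constructor
  · intro h
    obtain ⟨C, hC, hCt⟩ := exists_isCover_card_eq_tau (I.graph U)
    -- The power of a vertex is the number of its copies in the cover.
    refine ⟨fun u => (C.filter fun x => x.1 = u.1).card, fun u v huv => ?_, ?_⟩
    · by_contra hcon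
      push Not at hcon
      -- If fewer than `m` copies of `u` are in the cover, one of the first `m` is missing, and its
      -- index can be chosen at most `P` because the cover has at most `P` elements. Missing copies
      -- at both ends give an uncovered edge.
      have key : ∀ (u : Fin I.n) (m : ℕ), (C.filter fun x => x.1 = u.1).card < m →
          ∃ i < m, i < P + 1 ∧ (u.1, i) ∉ C := by
        intro u m hm
        by_contra hcon
        push Not at hcon
        have hsub : (Finset.range (min m (P + 1))).image (fun i => (u.1, i)) ⊆
            C.filter fun x => x.1 = u.1 := by
          intro x hx
          simp only [Finset.mem_image, Finset.mem_range, lt_min_iff] at hx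
          obtain ⟨i, ⟨h1, h2⟩, rfl⟩ := hx
          simpa using hcon i h1 h2
        have h1 := Finset.card_le_card hsub
        rw [Finset.card_image_of_injective _ (fun i j hij => by simpa using hij),
          Finset.card_range] at h1
        have h2 := Finset.card_filter_le C fun x => x.1 = u.1
        omega
      obtain ⟨i, hi, hiP, hiC⟩ := key u _ hcon.1
      obtain ⟨j, hj, hjP, hjC⟩ := key v _ hcon.2
      rcases hC ((u.1, i), (v.1, j)) (I.mem_graph.2 ⟨by omega, by omega, u.2, v.2, huv, hi, hj⟩)
        with h | h
      · exact hiC h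
      · exact hjC h
    · rw [← Finset.card_biUnion]
      · refine (Finset.card_le_card ?_).trans (hCt.le.trans h)
        intro x hx
        simp only [Finset.mem_biUnion, Finset.mem_filter] at hx
        obtain ⟨_, _, hx, _⟩ := hx
        exact hx
      · intro u _ v _ huv
        rw [Function.onFun, Finset.disjoint_left]
        intro x hx hx'
        simp only [Finset.mem_filter] at hx hx'
        exact huv (Fin.ext (hx.2.symm.trans hx'.2))
  · rintro ⟨p, hp, hP⟩
    -- Conversely, the first `p u` copies of every `u` form a cover.
    have hC : IsCover (I.graph U)
        (Finset.univ.biUnion fun u : Fin I.n => (Finset.range (p u)).image fun i => (u.1, i)) := by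
      rintro ⟨⟨u, i⟩, v, j⟩ he
      obtain ⟨-, -, hu, hv, huv, hi, hj⟩ := I.mem_graph.1 he
      simp only [Finset.mem_biUnion, Finset.mem_univ, true_and, Finset.mem_image, Finset.mem_range]
      rcases hp _ _ huv with h | h
      · exact Or.inl ⟨⟨u, hu⟩, i, hi.trans_le h, rfl⟩
      · exact Or.inr ⟨⟨v, hv⟩, j, hj.trans_le h, rfl⟩
    refine (tau_le_card hC).trans (Finset.card_biUnion_le.trans (le_trans ?_ hP))
    exact Finset.sum_le_sum fun u _ => Finset.card_image_le.trans (Finset.card_range _).le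

/-! ### The program -/

/-- Function `4`: a list of the given length. -/
def unaryBody : Exp :=
  .ifz (.var 0) (.lit 0) (.pair (.lit 0) (.call 4 (.sub (.var 0) (.lit 1))))

/-- `P` is given in binary, but the blown-up graph has size polynomial in `P` itself. Writing `P` in
unary makes the construction of the graph polynomial in the size of its input. -/
theorem eval_unaryBody {p : Prog} (h : p[4]? = some unaryBody) (k : ℕ) :
    ∃ t, Eval p [.num k] unaryBody (Enc.enc (List.replicate k 0)) t ∧ t ≤ (k + 1) * (20 + k) := by
  induction k with
  | zero => exact ⟨_, .ifz_zero (.var (by simp)) .lit, by simp⟩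
  | succ k ih =>
    obtain ⟨t, ht, hle⟩ := ih
    have hs : Eval p [.num (k + 1)] (.sub (.var 0) (.lit 1)) (.num k) _ :=
      .sub (x := k + 1) (y := 1) (.var rfl) .lit
    refine ⟨_, .ifz_nonzero (x := .num (k + 1)) (.var rfl) (by simp)
      (.pair .lit (.call hs h ht)), ?_⟩
    have h1 := size_le_self (k + 1)
    simp only [Nat.size_zero, Nat.size_one]
    nlinarith

/-- Function `0`; the initial node of the search tree is computed by `code`. -/
def mainBody (code : Exp) : Exp :=
  .bind (.call 4 (.snd (.var 0))) (.bind (.pair (.var 1) (.var 0)) (.bind code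
    (.bind (.call 1 (.var 0)) (.ifz (.sub (.var 0) (.snd (.var 4))) (.lit 1) (.lit 0)))))

/-- The initial node of the search tree. -/
def initial (x : (List (List ℕ) × ℕ) × List ℕ) : ℕ × List ((ℕ × ℕ) × (ℕ × ℕ)) :=
  (x.1.2, blow x.1.1 (0 :: x.2))

theorem polyF_initial : PolyF initial := by
  have h := polyF_blow.comp ((PolyF.fst (α := List (List ℕ) × ℕ) (β := List ℕ)).fst'.pair
    ((PolyF.const 0).cons PolyF.snd))
  exact PolyF.fst.snd'.pair h

theorem sz_replicate (k : ℕ) : sz (List.replicate k 0) = 2 * k + 1 := by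
  induction k with
  | zero => simp
  | succ k ih => rw [List.replicate_succ, sz_cons, ih]; simp; omega

/-- The truncated difference v - P vanishes exactly for YES. The capped value suffices, as P + 1
already means NO. -/
theorem eval_answer (A : Prog) {v P : ℕ} (r : Val) (hv : v ≤ P + 1) :
    ∃ t ≤ 20 + 2 * P, ∀ env : List Val, env[0]? = some (.num v) →
      env[4]? = some (.pair r (.num P)) →
      Eval A env (.ifz (.sub (.var 0) (.snd (.var 4))) (.lit 1) (.lit 0))
        (answer (decide (v ≤ P))) t := by
  have h2 := size_le_self P
  have h3 := (size_le_self v).trans hv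
  have hs : ∀ env : List Val, env[0]? = some (.num v) → env[4]? = some (.pair r (.num P)) →
      Eval A env (.sub (.var 0) (.snd (.var 4))) (.num (v - P))
        (1 + (1 + 1) + (1 + Nat.size v + Nat.size P)) :=
    fun env h0 h4 => .sub (.var h0) (.snd (.var h4))
  by_cases h : v ≤ P
  · rw [Nat.sub_eq_zero_of_le h] at hs
    simp only [h, decide_true, answer]
    exact ⟨_, by simp; omega, fun env h0 h4 => .ifz_zero (hs env h0 h4) .lit⟩
  · have hne : v - P ≠ 0 := by omega
    simp only [h, decide_false, answer]
    exact ⟨_, by simp; omega, fun env h0 h4 => .ifz_nonzero (hs env h0 h4) (by simpa using hne) .lit⟩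

theorem exists_prog : ∃ (A : Prog) (R : Polynomial ℕ), ∀ (I : Inst) (P : ℕ),
    ∃ (ans : Bool) (t : ℕ), A.Outputs (I.encode P) (answer ans) t ∧ (ans = true ↔ I.Solvable P) ∧
      (t : ℝ) ≤ R.eval ((I.encode P).size + 2 * P + 2) * base ^ P := by
  obtain ⟨Q, hQ⟩ := Search.eval_solve (polyF_expand (ν := ℕ × ℕ))
  obtain ⟨ext, code, hcode⟩ := hQ 5
  obtain ⟨q, hq⟩ := polyF_initial
  obtain ⟨ext', code', hcode'⟩ := hq (5 + ext.length)
  let A : Prog := [mainBody code', Search.solveBody code, Search.minBody, Search.sumBody,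
    unaryBody] ++ (ext ++ ext')
  have hA : Has A 5 (ext ++ ext') := fun i _ => by
    change ([mainBody code', Search.solveBody code, Search.minBody, Search.sumBody,
      unaryBody] ++ (ext ++ ext'))[5 + i]? = _
    rw [List.getElem?_append_right (by simp)]
    simp
  -- a bound on the sizes of the nodes and on the budget
  let m : Polynomial ℕ := q + .X
  -- The factor 150000 · m² bounds the coefficient 75000 · m · width of the root, whose width is at
  -- most 2m; `Q.comp m` is the cost per node, and the other terms pay for unary conversion, graph
  -- construction and the final test.
  refine ⟨A, 60 + 10 * (.X + 1) * (.X + 20) + q + 150000 * m * m * Q.comp m, fun I P => ?_⟩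
  set U := List.replicate P 0 with hU
  have hlen : (0 :: U).length = P + 1 := by simp [hU]
  set E := I.graph (0 :: U) with hE
  set n := (I.encode P).size + 2 * P + 2 with hn
  have hsz : sz ((I.rows, P), U) = n := by
    rw [sz_prod, hU, sz_replicate, hn, I.encode_eq]
    simp only [sz]; omega
  obtain ⟨t₁, ht₁, hle₁⟩ := eval_unaryBody (p := A) rfl P
  obtain ⟨t₂, ht₂, hle₂, hsz₂⟩ := hcode' A hA.right ((I.rows, P), U) [Enc.enc U, I.encode P]
  have hinit : initial ((I.rows, P), U) = (P, E) := rfl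
  rw [hinit] at ht₂ hsz₂
  rw [hsz] at hle₂ hsz₂
  have hm : m.eval n = q.eval n + n := by simp [m]
  have hPn : P ≤ n := by omega
  have hEm : E.length ≤ m.eval n := by
    have := length_lt_sz E
    simp only [sz_prod] at hsz₂
    omega
  -- The invariant of the nodes: symmetric sublists of the initial edge list with budget at most
  -- `P`. It gives one size bound for the whole tree.
  obtain ⟨t₃, ht₃, hle₃⟩ := hcode A hA.left rfl rfl rfl
    (fun s => Sym s.2 ∧ s.2.Sublist E ∧ s.1 ≤ P) val (nodes (m.eval n)) (m.eval n)
    (by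
      rintro ⟨k, E'⟩ ⟨-, h1, h2⟩
      have h3 := sz_sublist h1
      have h4 := Nat.size_le_size h2
      simp only [sz_prod, sz_nat] at hsz₂ h4 ⊢
      dsimp only at h2 h3
      omega)
    (by
      rintro ⟨k, E'⟩ ⟨h1, h2, h3⟩ x hx s hs
      obtain ⟨h4, h5, h6⟩ := expand_child h1 hx hs
      exact ⟨h6, h5.trans h2, h4.trans h3⟩)
    (by rintro ⟨k, E'⟩ ⟨h1, -, -⟩; exact val_expand h1 k)
    (fun s => mul_nonneg (by linarith [le_coef (by omega : 1 ≤ m.eval n) s.2])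
      (by linarith [one_le_base_pow s.1]))
    (by
      rintro ⟨k, E'⟩ ⟨h1, h2, -⟩
      exact nodes_expand (by omega) h1 (h2.length_le.trans hEm) k)
    (P, E) ⟨I.sym_graph _, List.Sublist.refl _, le_rfl⟩
  refine ⟨decide (val (P, E) ≤ P), ?_⟩
  obtain ⟨t₄, hle₄, ht₄⟩ := eval_answer A (v := val (P, E)) (P := P) (Enc.enc I.rows)
    (min_le_right _ _)
  have hx : I.encode P = .pair (Enc.enc I.rows) (.num P) := I.encode_eq P
  have hx' : Enc.enc ((I.rows, P), U) = .pair (I.encode P) (Enc.enc U) := by rw [hx]; rfl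
  have e₁ : Eval A [I.encode P] (.call 4 (.snd (.var 0))) (Enc.enc U) _ :=
    .call (.snd (x := Enc.enc I.rows) (.var (by rw [hx]; rfl))) rfl ht₁
  have e₂ : Eval A [Enc.enc U, I.encode P] (.pair (.var 1) (.var 0))
      (Enc.enc ((I.rows, P), U)) 3 := by
    rw [hx']; exact .pair (.var rfl) (.var rfl)
  have e₄ : ∀ env, Eval A (Enc.enc (P, E) :: env) (.call 1 (.var 0)) (.num (val (P, E))) _ :=
    fun env => .call (.var rfl) rfl ht₃
  refine ⟨_, .call (.var rfl) (rfl : A[0]? = some (mainBody code'))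
    (.bind e₁ (.bind e₂ (.bind ht₂ (.bind (e₄ _) (ht₄ _ rfl (congrArg some hx)))))), ?_, ?_⟩
  · rw [decide_eq_true_eq, ← I.tau_graph_le_iff hlen]
    change min (tau E) (P + 1) ≤ P ↔ tau E ≤ P
    omega
  · have hb := one_le_base_pow P
    have h1 : nodes (m.eval n) (P, E) ≤ 150000 * (m.eval n : ℕ) * (m.eval n : ℕ) * base ^ P := by
      have h2 := coef_le (by omega : 1 ≤ m.eval n) E
      have h3 : (width E : ℝ) ≤ 2 * (m.eval n : ℕ) := by
        have : width E ≤ 2 * m.eval n := by unfold width; omega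
        exact_mod_cast this
      have h4 : 75000 * ((m.eval n : ℕ) : ℝ) * width E ≤
        75000 * ((m.eval n : ℕ) : ℝ) * (2 * (m.eval n : ℕ)) := by gcongr
      unfold nodes
      have h5 : coef (m.eval n) E ≤ 150000 * (m.eval n : ℕ) * (m.eval n : ℕ) := by linarith
      exact mul_le_mul_of_nonneg_right h5 (by linarith)
    have h2 := mul_le_mul_of_nonneg_right h1 (Nat.cast_nonneg (α := ℝ) (Q.eval (m.eval n)))
    have h3 : (t₁ : ℝ) ≤ (n + 1) * (n + 20) := by
      have : t₁ ≤ (n + 1) * (n + 20) := hle₁.trans (Nat.mul_le_mul (by omega) (by omega))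
      exact_mod_cast this
    have h4 : (t₂ : ℝ) ≤ q.eval n := by exact_mod_cast hle₂
    have h5 : (t₄ : ℝ) ≤ 20 + 2 * n := by exact_mod_cast hle₄.trans (by omega)
    have h6 : (0 : ℝ) ≤ n := Nat.cast_nonneg n
    have h7 : ((60 + 10 * ((n : ℝ) + 1) * (n + 20) + (q.eval n : ℕ)) : ℝ) * 1 ≤
        (60 + 10 * ((n : ℝ) + 1) * (n + 20) + (q.eval n : ℕ)) * base ^ P := by gcongr
    simp only [Polynomial.eval_add, Polynomial.eval_mul, Polynomial.eval_ofNat, Polynomial.eval_X,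
      Polynomial.eval_one, Polynomial.eval_comp]
    push_cast
    nlinarith

end DPVC

/-! ### Absorbing the polynomial factor -/

namespace Cost

theorem exists_eval_le_mul_pow (R : Polynomial ℕ) :
    ∃ c d : ℕ, ∀ n, R.eval n ≤ c * (n + 1) ^ d := by
  induction R using Polynomial.induction_on' with
  | add p q hp hq =>
    obtain ⟨c, d, h⟩ := hp
    obtain ⟨c', d', h'⟩ := hq
    refine ⟨c + c', d + d', fun n => ?_⟩
    have h1 : (n + 1) ^ d ≤ (n + 1) ^ (d + d') := Nat.pow_le_pow_right (by omega) (by omega)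
    have h2 : (n + 1) ^ d' ≤ (n + 1) ^ (d + d') := Nat.pow_le_pow_right (by omega) (by omega)
    rw [Polynomial.eval_add, Nat.add_mul]
    exact Nat.add_le_add ((h n).trans (Nat.mul_le_mul_left _ h1))
      ((h' n).trans (Nat.mul_le_mul_left _ h2))
  | monomial d c =>
    refine ⟨c, d, fun n => ?_⟩
    rw [Polynomial.eval_monomial]
    gcongr
    omega

/-- A polynomial factor is absorbed by a larger base. -/
theorem exists_pow_mul_pow_le {a b : ℝ} (ha : 0 < a) (hab : a < b) (d : ℕ) :
    ∃ K : ℝ, ∀ n : ℕ, ((n : ℝ) + 1) ^ d * a ^ n ≤ K * b ^ n := by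
  have hb := ha.trans hab
  have hr : |a / b| < 1 := by
    rw [abs_of_pos (div_pos ha hb)]; exact (div_lt_one hb).2 hab
  -- The sequence n^d (a/b)^n tends to 0, hence is bounded; it is used at n + 1.
  obtain ⟨K, hK⟩ := (tendsto_pow_const_mul_const_pow_of_abs_lt_one d hr).bddAbove_range
  refine ⟨K * (b / a), fun n => ?_⟩
  have h := hK ⟨n + 1, rfl⟩
  dsimp only at h
  push_cast at h
  rw [div_pow, ← mul_div_assoc, div_le_iff₀ (by positivity)] at h
  have h2 := mul_le_mul_of_nonneg_right h (inv_nonneg.2 ha.le)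
  calc ((n : ℝ) + 1) ^ d * a ^ n = ((n : ℝ) + 1) ^ d * a ^ (n + 1) * a⁻¹ := by
        rw [pow_succ]; field_simp
    _ ≤ K * b ^ (n + 1) * a⁻¹ := h2
    _ = K * (b / a) * b ^ n := by rw [pow_succ]; field_simp

end Cost

theorem mainTheorem4 :
    ∃ (A : Cost.Prog) (C d : ℕ), ∀ (I : DPVC.Inst) (P : ℕ),
      ∃ (ans : Bool) (t : ℕ),
        A.Outputs (I.encode P) (DPVC.answer ans) t ∧
        (ans = true ↔ I.Solvable P) ∧
        (t : ℝ) ≤ (C : ℝ) * ((I.encode P).size : ℝ) ^ d * (1.325 : ℝ) ^ P := by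
  obtain ⟨A, R, h⟩ := DPVC.exists_prog
  obtain ⟨c, d, hR⟩ := Cost.exists_eval_le_mul_pow R
  obtain ⟨K, hK⟩ := Cost.exists_pow_mul_pow_le (a := VC.base) (b := 1.325) (by norm_num [VC.base])
    (by norm_num [VC.base]) d
  obtain ⟨C, hC⟩ := exists_nat_ge (c * 4 ^ d * K)
  refine ⟨A, C, d, fun I P => ?_⟩
  obtain ⟨ans, t, h1, h2, h3⟩ := h I P
  refine ⟨ans, t, h1, h2, h3.trans ?_⟩
  set s := (I.encode P).size with hs
  have hs1 : 1 ≤ s := by rw [hs, I.encode_eq]; exact Cost.sz_pos (I.rows, P)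
  -- As `s ≥ 1`, the argument satisfies s + 2P + 3 ≤ s · 4(P + 1), which separates the power of `s`
  -- from the power of P + 1 that the larger base absorbs.
  have h4 : R.eval (s + 2 * P + 2) ≤ c * (s * (4 * (P + 1))) ^ d := by
    refine (hR _).trans ?_
    gcongr
    nlinarith
  have h5 : ((R.eval (s + 2 * P + 2) : ℕ) : ℝ) ≤ c * ((s : ℝ) * (4 * (P + 1))) ^ d := by
    exact_mod_cast h4
  have hb : (0 : ℝ) < VC.base := by norm_num [VC.base]
  calc ((R.eval (s + 2 * P + 2) : ℕ) : ℝ) * VC.base ^ P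
      ≤ c * ((s : ℝ) * (4 * (P + 1))) ^ d * VC.base ^ P := by gcongr
    _ = c * 4 ^ d * (s : ℝ) ^ d * (((P : ℝ) + 1) ^ d * VC.base ^ P) := by
        rw [mul_pow, mul_pow]; ring
    _ ≤ c * 4 ^ d * (s : ℝ) ^ d * (K * 1.325 ^ P) := by
        exact mul_le_mul_of_nonneg_left (hK P) (by positivity)
    _ = c * 4 ^ d * K * (s : ℝ) ^ d * 1.325 ^ P := by ring
    _ ≤ C * (s : ℝ) ^ d * 1.325 ^ P := by gcongr
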